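/- Let $\Gamma$ be a grading group, i.e. an abelian group with a parity homomorphism $|\cdot|\colon\Gamma\to\mathbb Z/2\mathbb Z$ and a distinguished element $1\in\Gamma$ of odd parity. Let $A$ be a $\Gamma$-graded curved differential graded (cdg) ring: a $\Gamma$-graded associative unital ring with an additive map $\partial\colon A\to A$ of degree $1$ and an element $w\in A^{2}$ (where $2=1+1\in\Gamma$) such that $\partial(ab)=\partial(a)b+(-1)^{|a|}a\,\partial(b)$ for homogeneous $a$ and all $b$, $\partial(w)=0$, and $\partial^2(a)=wa-aw$ for all $a\in A$. Let $A\text{-Mod}$ be the category of cdg modules over $A$: the objects are $\Gamma$-graded left $A$-modules $X$ with an additive map $\partial\colon X\to X$ of degree $1$ such that $\partial(ax)=\partial(a)x+(-1)^{|a|}a\,\partial(x)$ for homogeneous $a$ and $\partial^2(x)=wx$; the morphisms are the $A$-linear maps of degree $0$ that commute with $\partial$. Write $A^\sharp$ for the underlying graded ring of $A$ and $X^\sharp$ for the underlying graded $A^\sharp$-module of $X$. A model structure on a bicomplete abelian category is called abelian if the cofibrations are exactly the monomorphisms with cofibrant cokernel and the fibrations are exactly the epimorphisms with fibrant kernel;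 an abelian model structure is called projective if every object is fibrant, and injective if every object is cofibrant. A model structure is cofibrantly generated if there are sets $I$ and $J$ of morphisms, both permitting the small object argument, such that the trivial fibrations are the morphisms with the right lifting property with respect to $I$ and the fibrations are the morphisms with the right lifting property with respect to $J$. Then $A\text{-Mod}$ is a bicomplete abelian category, and the following hold. 1. There is a unique projective abelian model structure $\mathcal M^{\mathrm{ctr}}(A)$ on $A\text{-Mod}$ whose cofibrant objects are exactly the $X$ such that $X^\sharp$ is projective in the category of graded $A^\sharp$-modules. 2. There is a unique injective abelian model structure $\mathcal M^{\mathrm{co}}(A)$ on $A\text{-Mod}$ whose fibrant objects are exactly the $X$ such that $X^\sharp$ is injective in the category of graded $A^\sharp$-modules. Moreover, $\mathcal M^{\mathrm{ctr}}(A)$ and $\mathcal M^{\mathrm{co}}(A)$ are cofibrantly generated. -/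

import Mathlib

open CategoryTheory CategoryTheory.Limits HomotopicalAlgebra

universe u

namespace CDG

/-! ### Grading groups, curved differential graded rings -/

/-- A grading group: an abelian group `Γ` with a parity homomorphism to `ℤ/2` and a distinguished
element `1` of odd parity. -/
structure GradingGroup (Γ : Type u) [AddCommGroup Γ] where
  parity : Γ →+ ZMod 2
  one : Γ
  parity_one : parity one = 1

/-- The sign `(-1)^{|n|}`. -/
def GradingGroup.sign {Γ : Type u} [AddCommGroup Γ] (G : GradingGroup Γ) (n : Γ) : ℤˣ :=
  (-1 : ℤˣ) ^ G.parity n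

/-- The structure of a curved differential graded ring on a `Γ`-graded ring `A = ⨁ 𝒜 n`:
a differential `d` of degree `1` satisfying the Leibniz rule and a curvature element `w` of
degree `2 = 1 + 1` such that `d w = 0` and `d (d x) = [w, x]`. -/
structure CDGStructure {Γ : Type u} [AddCommGroup Γ] [DecidableEq Γ] (G : GradingGroup Γ)
    {A : Type u} [Ring A] (𝒜 : Γ → AddSubgroup A) [GradedRing 𝒜] where
  d : A →+ A
  d_mem : ∀ {n : Γ} {a : A}, a ∈ 𝒜 n → d a ∈ 𝒜 (n + G.one)
  leibniz : ∀ {n : Γ} {a : A}, a ∈ 𝒜 n → ∀ b : A, d (a * b) = d a * b + G.sign n • (a * d b)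
  w : A
  w_mem : w ∈ 𝒜 (G.one + G.one)
  d_w : d w = 0
  d_d : ∀ a : A, d (d a) = w * a - a * w

/-! ### Graded modules -/

section GrMod

variable {Γ : Type u} [AddCommGroup Γ] [DecidableEq Γ] {A : Type u} [Ring A]

/-- A `Γ`-graded (left) module over the `Γ`-graded ring `A = ⨁ 𝒜 n`: a `Γ`-indexed family of abelian
groups with an associative unital action `𝒜 p × X q → X (p + q)`. The action is given for all
`p`, `q`, `r` with a proof of `p + q = r`, in order to avoid casts. -/
structure GrMod (𝒜 : Γ → AddSubgroup A) [GradedRing 𝒜] where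
  X : Γ → Type u
  [grp : ∀ n, AddCommGroup (X n)]
  act : ∀ {p q r : Γ}, p + q = r → (𝒜 p →+ X q →+ X r)
  one_act : ∀ {q : Γ} (x : X q), act (zero_add q) ⟨1, SetLike.GradedOne.one_mem⟩ x = x
  mul_act : ∀ {p p' q r s : Γ} (h : p' + q = r) (h' : p + r = s) (a : 𝒜 p) (b : 𝒜 p') (x : X q),
    act (p := p + p') (by rw [add_assoc, h, h']) ⟨a * b, SetLike.GradedMul.mul_mem a.2 b.2⟩ x =
      act h' a (act h b x)

attribute [instance] GrMod.grp

variable {𝒜 : Γ → AddSubgroup A} [GradedRing 𝒜]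

/-- Morphisms of graded modules: families of additive maps commuting with the action. -/
@[ext]
structure GrMod.Hom (X Y : GrMod 𝒜) where
  f : ∀ n, X.X n →+ Y.X n
  map_act : ∀ {p q r : Γ} (h : p + q = r) (a : 𝒜 p) (x : X.X q),
    f r (X.act h a x) = Y.act h a (f q x)

instance : Category (GrMod 𝒜) where
  Hom X Y := GrMod.Hom X Y
  id X := { f := fun _ => AddMonoidHom.id _, map_act := fun _ _ _ => rfl }
  comp φ ψ :=
    { f := fun n => (ψ.f n).comp (φ.f n)
      map_act := fun h a x => by simp [φ.map_act, ψ.map_act] }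

end GrMod

/-! ### Modules over a cdg ring -/

variable {Γ : Type u} [AddCommGroup Γ] [DecidableEq Γ] {G : GradingGroup Γ} {A : Type u} [Ring A]
  {𝒜 : Γ → AddSubgroup A} [GradedRing 𝒜]

/-- A cdg module over a cdg ring: a graded module with a differential `d` of degree `1` such that
`d (a x) = (d a) x + (-1)^{|a|} a (d x)` and `d (d x) = w x`. -/
structure CDGMod (D : CDGStructure G 𝒜) extends GrMod 𝒜 where
  d : ∀ {n m : Γ}, n + G.one = m → (X n →+ X m)
  leibniz : ∀ {p q r s : Γ} (h : p + q = r) (h' : r + G.one = s) (a : 𝒜 p) (x : X q),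
    d h' (act h a x) =
      act (p := p + G.one) (q := q) (by rw [add_right_comm, h, h']) ⟨D.d a, D.d_mem a.2⟩ x +
      G.sign p • act (p := p) (q := q + G.one) (by rw [← add_assoc, h, h']) a (d rfl x)
  d_d : ∀ {n m k : Γ} (h : n + G.one = m) (h' : m + G.one = k) (x : X n),
    d h' (d h x) =
      act (p := G.one + G.one) (by rw [← h', ← h, add_comm, add_assoc]) ⟨D.w, D.w_mem⟩ x

namespace CDGMod

variable {D : CDGStructure G 𝒜}

/-- Morphisms of cdg modules: morphisms of graded modules commuting with the differentials. -/
structure Hom (X Y : CDGMod D) extends GrMod.Hom X.toGrMod Y.toGrMod where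
  comm : ∀ {n m : Γ} (h : n + G.one = m) (x : X.X n), f m (X.d h x) = Y.d h (f n x)

instance : Category (CDGMod D) where
  Hom X Y := Hom X Y
  id X := { f := fun _ => AddMonoidHom.id _, map_act := fun _ _ _ => rfl, comm := fun _ _ => rfl }
  comp φ ψ :=
    { f := fun n => (ψ.f n).comp (φ.f n)
      map_act := fun h a x => by simp [φ.map_act, ψ.map_act]
      comm := fun h x => by simp [φ.comm, ψ.comm] }

/-- The functor forgetting the differential. -/
def forget (D : CDGStructure G 𝒜) : CDGMod D ⥤ GrMod 𝒜 where
  obj X := X.toGrMod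
  map φ := φ.toHom

/-- The class of cdg modules whose underlying graded module is projective. -/
def IsGradedProjective (X : CDGMod D) : Prop := Projective ((forget D).obj X)

/-- The class of cdg modules whose underlying graded module is injective. -/
def IsGradedInjective (X : CDGMod D) : Prop := Injective ((forget D).obj X)

/-! ### The category of cdg modules is abelian -/

@[ext]
lemma hom_ext {X Y : CDGMod D} {φ ψ : X ⟶ Y} (h : ∀ n x, φ.f n x = ψ.f n x) : φ = ψ := by
  obtain ⟨⟨f, _⟩, _⟩ := φ
  obtain ⟨⟨g, _⟩, _⟩ := ψ
  obtain rfl : f = g := by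
    funext n
    exact AddMonoidHom.ext (h n)
  rfl

@[simp]
lemma comp_f {X Y Z : CDGMod D} (φ : X ⟶ Y) (ψ : Y ⟶ Z) (n : Γ) (x : X.X n) :
    (φ ≫ ψ).f n x = ψ.f n (φ.f n x) := rfl

@[simp]
lemma id_f (X : CDGMod D) (n : Γ) (x : X.X n) : (Hom.toHom (𝟙 X)).f n x = x := rfl

section Preadditive

variable (X Y : CDGMod D)

instance : Zero (X ⟶ Y) where
  zero := ({ f := fun _ => 0, map_act := by simp, comm := by simp } : Hom X Y)

instance : Add (X ⟶ Y) where
  add φ ψ := ({ f := fun n => φ.f n + ψ.f n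
                map_act := by simp [φ.map_act, ψ.map_act]
                comm := by simp [φ.comm, ψ.comm] } : Hom X Y)

instance : Neg (X ⟶ Y) where
  neg φ := ({ f := fun n => -φ.f n
              map_act := by simp [φ.map_act]
              comm := by simp [φ.comm] } : Hom X Y)

variable {X Y}

@[simp] lemma zero_f (n : Γ) (x : X.X n) : (Hom.toHom (0 : X ⟶ Y)).f n x = 0 := rfl
@[simp] lemma add_f (φ ψ : X ⟶ Y) (n : Γ) (x : X.X n) : (φ + ψ).f n x = φ.f n x + ψ.f n x := rfl
@[simp] lemma neg_f (φ : X ⟶ Y) (n : Γ) (x : X.X n) : (-φ).f n x = -φ.f n x := rfl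

instance : AddCommGroup (X ⟶ Y) where
  add_assoc _ _ _ := by ext; simp [add_assoc]
  zero_add _ := by ext; simp
  add_zero _ := by ext; simp
  neg_add_cancel _ := by ext; simp
  add_comm _ _ := by ext; simp [add_comm]
  nsmul := nsmulRec
  zsmul := zsmulRec

instance : Preadditive (CDGMod D) where

end Preadditive

/-- The zero module. -/
def zeroObj (D : CDGStructure G 𝒜) : CDGMod D where
  X _ := PUnit
  act _ := 0
  one_act _ := rfl
  mul_act _ _ _ _ _ := rfl
  d _ := 0
  leibniz _ _ _ _ := rfl
  d_d _ _ _ := rfl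

instance : HasZeroObject (CDGMod D) where
  zero := ⟨zeroObj D, by
    rw [IsZero.iff_id_eq_zero]
    ext
    rfl⟩

/-- The degreewise direct sum of two modules. -/
def prod (X Y : CDGMod D) : CDGMod D where
  X n := X.X n × Y.X n
  act h := AddMonoidHom.mk' (fun a => (X.act h a).prodMap (Y.act h a))
    (fun a b => by ext <;> simp)
  one_act x := Prod.ext (X.one_act _) (Y.one_act _)
  mul_act h h' a b x := Prod.ext (X.mul_act h h' a b _) (Y.mul_act h h' a b _)
  d h := (X.d h).prodMap (Y.d h)
  leibniz h h' a x := Prod.ext (X.leibniz h h' a _) (Y.leibniz h h' a _)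
  d_d h h' x := Prod.ext (X.d_d h h' _) (Y.d_d h h' _)

instance : HasFiniteProducts (CDGMod D) :=
  have : HasBinaryBiproducts (CDGMod D) := ⟨fun X Y => hasBinaryBiproduct_of_total
    { pt := prod X Y
      fst := ({ f := fun _ => AddMonoidHom.fst _ _
                map_act := fun _ _ _ => rfl
                comm := fun _ _ => rfl } : Hom _ _)
      snd := ({ f := fun _ => AddMonoidHom.snd _ _
                map_act := fun _ _ _ => rfl
                comm := fun _ _ => rfl } : Hom _ _)
      inl := ({ f := fun _ => AddMonoidHom.inl _ _
                map_act := fun h a x => Prod.ext (Eq.refl (X.act h a x)) (map_zero (Y.act h a)).symm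
                comm := fun h x => Prod.ext (Eq.refl (X.d h x)) (map_zero (Y.d h)).symm } : Hom _ _)
      inr := ({ f := fun _ => AddMonoidHom.inr _ _
                map_act := fun h a x => Prod.ext (map_zero (X.act h a)).symm (Eq.refl (Y.act h a x))
                comm := fun h x => Prod.ext (map_zero (X.d h)).symm (Eq.refl (Y.d h x)) } : Hom _ _)
      inl_fst := rfl
      inl_snd := rfl
      inr_fst := rfl
      inr_snd := rfl }
    (hom_ext fun _ _ => Prod.ext (add_zero _) (zero_add _))⟩
  hasFiniteProducts_of_has_binary_and_terminal

variable {X Y : CDGMod D}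

lemma congr_f {φ ψ : X ⟶ Y} (h : φ = ψ) (n : Γ) (x : X.X n) : φ.f n x = ψ.f n x := by
  rw [h]

/-- The kernel of a morphism. -/
def ker (φ : X ⟶ Y) : CDGMod D where
  X n := (φ.f n).ker
  act h := AddMonoidHom.mk' (fun a => ((X.act h a).comp (AddSubgroup.subtype _)).codRestrict _
      (fun x => by
        have hx : φ.f _ x.1 = 0 := x.2
        simp [AddMonoidHom.mem_ker, φ.map_act, hx]))
    (fun a b => by
      ext x
      exact DFunLike.congr_fun (map_add (X.act h) a b) x.1)
  one_act x := Subtype.ext (X.one_act _)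
  mul_act h h' a b x := Subtype.ext (X.mul_act h h' a b _)
  d h := ((X.d h).comp (AddSubgroup.subtype _)).codRestrict _
      (fun x => by
        have hx : φ.f _ x.1 = 0 := x.2
        simp [AddMonoidHom.mem_ker, φ.comm, hx])
  leibniz h h' a x := Subtype.ext (X.leibniz h h' a _)
  d_d h h' x := Subtype.ext (X.d_d h h' _)

/-- The inclusion of the kernel. -/
def kerι (φ : X ⟶ Y) : ker φ ⟶ X :=
  ({ f := fun _ => AddSubgroup.subtype _
     map_act := fun _ _ _ => rfl
     comm := fun _ _ => rfl } : Hom _ _)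

lemma kerι_comp (φ : X ⟶ Y) : kerι φ ≫ φ = 0 :=
  hom_ext fun _ x => x.2

instance : HasKernels (CDGMod D) where
  has_limit φ := ⟨⟨⟨_, KernelFork.IsLimit.ofι (kerι φ) (kerι_comp φ)
    (fun {W} ψ hψ => ({
        f := fun n => (ψ.f n).codRestrict _
          (fun x => congr_f hψ n x)
        map_act := fun h a x => Subtype.ext (ψ.map_act h a x)
        comm := fun h x => Subtype.ext (ψ.comm h x) } : Hom W (ker φ)))
    (fun _ _ => rfl)
    (fun _ _ _ hm => hom_ext fun n x => Subtype.ext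
      (congr_f hm n x))⟩⟩⟩

/-- The cokernel of a morphism. -/
def coker (φ : X ⟶ Y) : CDGMod D where
  X n := Y.X n ⧸ (φ.f n).range
  act h := AddMonoidHom.mk' (fun a => QuotientAddGroup.map _ _ (Y.act h a) (by
        rintro _ ⟨x, rfl⟩
        exact ⟨X.act h a x, φ.map_act h a x⟩))
    (fun a b => by
      ext x
      exact congr_arg (QuotientAddGroup.mk) (DFunLike.congr_fun (map_add (Y.act h) a b) x))
  one_act x := by
    obtain ⟨y, rfl⟩ := QuotientAddGroup.mk_surjective x
    exact congr_arg QuotientAddGroup.mk (Y.one_act y)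
  mul_act h h' a b x := by
    obtain ⟨y, rfl⟩ := QuotientAddGroup.mk_surjective x
    exact congr_arg QuotientAddGroup.mk (Y.mul_act h h' a b y)
  d h := QuotientAddGroup.map _ _ (Y.d h) (by
        rintro _ ⟨x, rfl⟩
        exact ⟨X.d h x, φ.comm h x⟩)
  leibniz h h' a x := by
    obtain ⟨y, rfl⟩ := QuotientAddGroup.mk_surjective x
    exact congr_arg QuotientAddGroup.mk (Y.leibniz h h' a y)
  d_d h h' x := by
    obtain ⟨y, rfl⟩ := QuotientAddGroup.mk_surjective x
    exact congr_arg QuotientAddGroup.mk (Y.d_d h h' y)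

/-- The projection to the cokernel. -/
def cokerπ (φ : X ⟶ Y) : Y ⟶ coker φ :=
  ({ f := fun _ => QuotientAddGroup.mk' _
     map_act := fun _ _ _ => rfl
     comm := fun _ _ => rfl } : Hom _ _)

lemma comp_cokerπ (φ : X ⟶ Y) : φ ≫ cokerπ φ = 0 :=
  hom_ext fun _ x => (QuotientAddGroup.eq_zero_iff _).2 ⟨x, rfl⟩

instance : HasCokernels (CDGMod D) where
  has_colimit φ := ⟨⟨⟨_, CokernelCofork.IsColimit.ofπ (cokerπ φ) (comp_cokerπ φ)
    (fun {W} ψ hψ => ({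
        f := fun n => QuotientAddGroup.lift _ (ψ.f n) (by
          rintro _ ⟨x, rfl⟩
          exact congr_f hψ n x)
        map_act := fun h a x => by
          obtain ⟨y, rfl⟩ := QuotientAddGroup.mk_surjective x
          exact ψ.map_act h a y
        comm := fun h x => by
          obtain ⟨y, rfl⟩ := QuotientAddGroup.mk_surjective x
          exact ψ.comm h y } : Hom (coker φ) W))
    (fun _ _ => rfl)
    (fun _ _ _ hm => hom_ext fun n x => by
      obtain ⟨y, rfl⟩ := QuotientAddGroup.mk_surjective x
      exact congr_f hm n y)⟩⟩⟩

lemma injective_of_mono (φ : X ⟶ Y) [Mono φ] (n : Γ) : Function.Injective (φ.f n) := by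
  rw [injective_iff_map_eq_zero]
  intro x hx
  have h : kerι φ = 0 := zero_of_comp_mono φ (kerι_comp φ)
  exact congr_f h n ⟨x, hx⟩

lemma surjective_of_epi (φ : X ⟶ Y) [Epi φ] (n : Γ) : Function.Surjective (φ.f n) := by
  intro y
  have h : cokerπ φ = 0 := zero_of_epi_comp φ (comp_cokerπ φ)
  exact (QuotientAddGroup.eq_zero_iff _).1 (congr_f h n y)

noncomputable instance : Abelian (CDGMod D) where
  normalMonoOfMono {X Y} φ _ := by
    have inj := injective_of_mono φ
    refine ⟨⟨_, cokerπ φ, comp_cokerπ φ, KernelFork.IsLimit.ofι' _ _ fun {W} ψ hψ => ?_⟩⟩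
    have h : ∀ n (x : W.X n), ∃ y, φ.f n y = ψ.f n x := fun n x =>
      (QuotientAddGroup.eq_zero_iff _).1 (congr_f hψ n x)
    choose g hg using h
    refine ⟨({ f := fun n => AddMonoidHom.mk' (g n) fun a b => inj n ?_
               map_act := fun h a x => inj _ ?_
               comm := fun h x => inj _ ?_ } : Hom W X), hom_ext hg⟩
    · simp [hg]
    · simp [hg, φ.map_act, ψ.map_act]
    · simp [hg, φ.comm, ψ.comm]
  normalEpiOfEpi {X Y} φ _ := by
    have surj := surjective_of_epi φ
    refine ⟨⟨_, kerι φ, kerι_comp φ, CokernelCofork.IsColimit.ofπ' _ _ fun {W} ψ hψ => ?_⟩⟩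
    have key : ∀ n (x y : X.X n), φ.f n x = φ.f n y → ψ.f n x = ψ.f n y := fun n x y hxy => by
      have := congr_f hψ n ⟨x - y, by simp [AddMonoidHom.mem_ker, hxy]⟩
      exact sub_eq_zero.1 ((map_sub (ψ.f n) x y).symm.trans this)
    choose g hg using surj
    refine ⟨({ f := fun n => AddMonoidHom.mk' (fun y => ψ.f n (g n y)) fun a b => ?_
               map_act := fun h a y => ?_
               comm := fun h y => ?_ } : Hom Y W), hom_ext fun n x => key n _ _ (hg n _)⟩
    · rw [← map_add]
      exact key _ _ _ (by simp [hg])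
    · exact (key _ _ _ (by simp [hg, φ.map_act])).trans (ψ.map_act _ _ _)
    · exact (key _ _ _ (by simp [hg, φ.comm])).trans (ψ.comm _ _)

end CDGMod

/-! ### Abelian model structures -/

section Model

variable {C : Type*} [Category C]

/-- A model structure on an abelian category is abelian if the cofibrations are the monomorphisms
with cofibrant cokernel and the fibrations are the epimorphisms with fibrant kernel. -/
structure IsAbelianModel [Abelian C] (M : ModelCategory C) : Prop where
  cofibration_iff : ∀ {X Y : C} (f : X ⟶ Y), Cofibration f ↔ Mono f ∧ IsCofibrant (cokernel f)
  fibration_iff : ∀ {X Y : C} (f : X ⟶ Y), Fibration f ↔ Epi f ∧ IsFibrant (kernel f)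

/-- A projective abelian model structure: every object is fibrant. -/
def IsProjectiveAbelianModel [Abelian C] (M : ModelCategory C) : Prop :=
  IsAbelianModel M ∧ ∀ X : C, IsFibrant X

/-- An injective abelian model structure: every object is cofibrant. -/
def IsInjectiveAbelianModel [Abelian C] (M : ModelCategory C) : Prop :=
  IsAbelianModel M ∧ ∀ X : C, IsCofibrant X

/-- A model structure is cofibrantly generated if there are sets (`u`-small families) `I` and `J` of
morphisms, both permitting the small object argument, such that the trivial fibrations are the
morphisms with the right lifting property with respect to `I`, and the fibrations are the morphisms
with the right lifting property with respect to `J`. -/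
def IsCofibrantlyGenerated (M : ModelCategory C) : Prop :=
  ∃ I J : MorphismProperty C,
    MorphismProperty.IsSmall.{u} I ∧ MorphismProperty.IsSmall.{u} J ∧
    MorphismProperty.HasSmallObjectArgument.{u} I ∧
    MorphismProperty.HasSmallObjectArgument.{u} J ∧
    trivialFibrations C = I.rlp ∧ fibrations C = J.rlp

end Model

/-- A model structure on the category of cdg modules is the contraderived one if it is a projective
abelian model structure whose cofibrant objects are the graded-projective modules. -/
def IsContraderivedModel {D : CDGStructure G 𝒜} (M : ModelCategory (CDGMod D)) : Prop :=
  IsProjectiveAbelianModel M ∧ ∀ X : CDGMod D, IsCofibrant X ↔ X.IsGradedProjective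

/-- A model structure on the category of cdg modules is the coderived one if it is an injective
abelian model structure whose fibrant objects are the graded-injective modules. -/
def IsCoderivedModel {D : CDGStructure G 𝒜} (M : ModelCategory (CDGMod D)) : Prop :=
  IsInjectiveAbelianModel M ∧ ∀ X : CDGMod D, IsFibrant X ↔ X.IsGradedInjective

end CDG

/-! Both model structures come from one formal argument in an abelian category with a class `P` of
objects, applied once directly and once in the opposite category. Cofibrations are the monomorphisms
with cokernel in `P`, fibrations are the epimorphisms, and weak equivalences are the maps inducing
bijections on Hom(X, -), X in `P`, modulo maps factoring through projectives. The axioms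
`IsCofibrantClass` say in essence that `P` behaves like a Frobenius category: projectives lie in
`P`, maps to projectives extend along cofibrations, and each object of `P` embeds in a projective
with cokernel in `P` and is a quotient of a projective with kernel in `P`. The key identities are
`weq_inf_epi` and `cof_inf_weq`, which identify the trivial fibrations and the trivial cofibrations
by lifting properties.

For cdg modules these axioms come from contractible modules. The forgetful functor to graded modules
has a right adjoint `coneFunctor`, which has in turn the shifted forgetful functor as right adjoint.
Hence `coneFunctor` preserves projectives and injectives, while its unit X → cone and counit cone →
X split as maps of graded modules. This gives the embeddings and presentations, and extends maps to
contractible modules along graded split monomorphisms.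

What remains is factorization. The category of cdg modules is Grothendieck abelian, so the small
object argument applies to every set of monomorphisms. In the coderived case a set of generators is
found by Baer's criterion, transported along the adjunctions (`rlp_coderivedGenerators`). In the
contraderived case one must show that cofibrations into free modules on countably many generators
suffice (`rlp_contraderivedGenerators`). A graded projective X is a graded summand of a free module
on a set B; the image in X of a basis element, and the differential of that image, involve only
finitely many basis elements. So every element of B lies in a countable set closed under taking such
supports, closed sets give cdg submodules of X, and adjoining a countable closed set changes the
submodule by a graded projective quotient. Zorn's lemma then splits every extension of X by a module
that passes the countable test (`exists_section_of_gradedProjective`). -/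

/-! ### Abelian model structures from a class of cofibrant objects -/

namespace AbelianModel

open scoped ZeroObject

section Lifting

variable {C : Type*} [Category C] [Abelian C]

/-- A monomorphism has the left lifting property against an epimorphism as soon as maps to the
kernel extend along some projective presentation of the cokernel. -/
lemma hasLiftingProperty_of_extension {A B X Y Q : C} (i : A ⟶ B) [Mono i] (f : X ⟶ Y) [Epi f]
    [Projective Q] (q : Q ⟶ cokernel i) [Epi q]
    (h : ∀ k : kernel q ⟶ kernel f, ∃ k' : Q ⟶ kernel f, kernel.ι q ≫ k' = k) :
    HasLiftingProperty i f where
  sq_hasLift {a b} sq := by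
    let u : Q ⟶ B := Projective.factorThru q (cokernel.π i)
    have hu : u ≫ cokernel.π i = q := Projective.factorThru_comp _ _
    let v : kernel q ⟶ A := Abelian.monoLift i (kernel.ι q ≫ u) (by simp [hu])
    have hv : v ≫ i = kernel.ι q ≫ u := Abelian.monoLift_comp _ _ _
    let l₀ : Q ⟶ X := Projective.factorThru (u ≫ b) f
    have hl₀ : l₀ ≫ f = u ≫ b := Projective.factorThru_comp _ _
    obtain ⟨k, hk⟩ := h (kernel.lift f (kernel.ι q ≫ l₀ - v ≫ a) (by
      rw [Preadditive.sub_comp, Category.assoc, Category.assoc, hl₀, sq.w, reassoc_of% hv,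
        sub_self]))
    have hk' : kernel.ι q ≫ k ≫ kernel.ι f = kernel.ι q ≫ l₀ - v ≫ a := by
      rw [← Category.assoc, hk, kernel.lift_ι]
    let l : Q ⟶ X := l₀ - k ≫ kernel.ι f
    have hl : kernel.ι q ≫ l = v ≫ a := by
      rw [Preadditive.comp_sub, hk', sub_sub_cancel]
    have hlf : l ≫ f = u ≫ b := by simp [l, hl₀]
    -- The kernel of the epimorphism `φ` is a copy of `kernel q`, embedded by `(-v, kernel.ι q)`.
    -- Hence a map out of `B` is a pair `(a, l)` with `kernel.ι q ≫ l = v ≫ a`, which the correction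
    -- of `l₀` by `k` achieves.
    let φ : A ⊞ Q ⟶ B := biprod.desc i u
    have : Epi φ := by
      rw [Preadditive.epi_iff_cancel_zero]
      intro Z g hg
      have h₁ : i ≫ g = 0 := by simpa [φ] using biprod.inl ≫= hg
      have h₂ : u ≫ g = 0 := by simpa [φ] using biprod.inr ≫= hg
      have h₃ : q ≫ cokernel.desc i g h₁ = 0 := by
        rw [← hu, Category.assoc, cokernel.π_desc, h₂]
      rw [← cokernel.π_desc i g h₁, zero_of_epi_comp _ h₃, comp_zero]
    have key : kernel.ι φ ≫ biprod.desc a l = 0 := by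
      have e : kernel.ι φ ≫ φ = 0 := kernel.condition φ
      obtain ⟨α, hα⟩ : ∃ α, α = kernel.ι φ ≫ biprod.fst := ⟨_, rfl⟩
      obtain ⟨β, hβ⟩ : ∃ β, β = kernel.ι φ ≫ biprod.snd := ⟨_, rfl⟩
      have hφ : kernel.ι φ = biprod.lift α β := by ext <;> simp [hα, hβ]
      rw [hφ] at e ⊢
      simp only [φ, biprod.lift_desc] at e ⊢
      have hβq : β ≫ q = 0 := by
        have := e =≫ cokernel.π i
        simpa [hu] using this
      obtain ⟨γ, hγ⟩ : ∃ γ, γ ≫ kernel.ι q = β := ⟨kernel.lift q β hβq, kernel.lift_ι _ _ _⟩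
      have hα' : α = -(γ ≫ v) := by
        rw [← cancel_mono i, Preadditive.neg_comp, Category.assoc, hv, reassoc_of% hγ]
        exact eq_neg_of_add_eq_zero_left e
      rw [hα', ← hγ, Category.assoc, hl]
      simp
    refine ⟨⟨{ l := Abelian.epiDesc φ (biprod.desc a l) key, fac_left := ?_, fac_right := ?_ }⟩⟩
    · have h₁ : i = biprod.inl ≫ φ := by simp [φ]
      rw [h₁, Category.assoc, Abelian.comp_epiDesc, biprod.inl_desc]
    · rw [← cancel_epi φ, Abelian.comp_epiDesc_assoc]
      ext
      · simp [φ, sq.w]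
      · simp [φ, hlf]

variable (P : ObjectProperty C)

/-- The monomorphisms whose cokernel belongs to a given class. -/
def cof : MorphismProperty C := fun _ _ i => Mono i ∧ P (cokernel i)

/-- The epimorphisms whose kernel belongs to a given class. -/
def fib : MorphismProperty C := fun _ _ f => Epi f ∧ P (kernel f)

/-- The conditions on a class of objects ensuring that it is the class of cofibrant objects of a
projective abelian model structure. -/
structure IsCofibrantClass : Prop where
  retract : P.IsStableUnderRetracts
  of_projective : ∀ X, Projective X → P X
  extension : ∀ {A B E : C} (i : A ⟶ B), cof P i → Projective E → ∀ a : A ⟶ E,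
    ∃ b : B ⟶ E, i ≫ b = a
  embedding : ∀ X, P X → ∃ (J : C) (ι : X ⟶ J), Projective J ∧ cof P ι
  presentation : ∀ X, P X → ∃ (Q : C) (π : Q ⟶ X), Projective Q ∧ fib P π
  enoughProjectives : EnoughProjectives C
  factorization : (cof P).HasFactorization (cof P).rlp

variable {P}

lemma cof_isStableUnderRetracts (hP : P.IsStableUnderRetracts) :
    (cof P).IsStableUnderRetracts where
  of_retract {X Y Z W f g} h hg := by
    have : Mono g := hg.1
    have : Mono f := (MorphismProperty.monomorphisms C).of_retract h this
    refine ⟨this, P.prop_of_retract (Y := cokernel g) ?_ hg.2⟩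
    exact { i := cokernel.map _ _ h.i.left h.i.right (by simp)
            r := cokernel.map _ _ h.r.left h.r.right (by simp)
            retract := by
              have h₁ : h.i.right ≫ h.r.right = 𝟙 _ := congr_arg (fun k => k.right) h.retract
              ext
              simp [reassoc_of% h₁] }

/-- The morphisms that factor through a projective object. -/
def IsNull {X Y : C} (g : X ⟶ Y) : Prop :=
  ∃ (R : C) (a : X ⟶ R) (b : R ⟶ Y), Projective R ∧ a ≫ b = g

lemma IsNull.add {X Y : C} {g g' : X ⟶ Y} (h : IsNull g) (h' : IsNull g') : IsNull (g + g') := by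
  obtain ⟨R, a, b, _, rfl⟩ := h
  obtain ⟨R', a', b', _, rfl⟩ := h'
  exact ⟨R ⊞ R', biprod.lift a a', biprod.desc b b', inferInstance, by simp⟩

lemma IsNull.neg {X Y : C} {g : X ⟶ Y} (h : IsNull g) : IsNull (-g) := by
  obtain ⟨R, a, b, _, rfl⟩ := h
  exact ⟨R, -a, b, inferInstance, by simp⟩

lemma IsNull.sub {X Y : C} {g g' : X ⟶ Y} (h : IsNull g) (h' : IsNull g') : IsNull (g - g') := by
  rw [sub_eq_add_neg]
  exact h.add h'.neg

omit [Abelian C] in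
lemma IsNull.comp {X Y Z : C} {g : X ⟶ Y} (h : IsNull g) (f : Y ⟶ Z) : IsNull (g ≫ f) := by
  obtain ⟨R, a, b, _, rfl⟩ := h
  exact ⟨R, a, b ≫ f, inferInstance, by simp⟩

lemma isNull_zero {X Y : C} : IsNull (0 : X ⟶ Y) := ⟨0, 0, 0, inferInstance, by simp⟩

lemma IsNull.exists_extension (hP : IsCofibrantClass P) {A B Y : C} {i : A ⟶ B} (hi : cof P i)
    {g : A ⟶ Y} (h : IsNull g) : ∃ g' : B ⟶ Y, i ≫ g' = g := by
  obtain ⟨R, a, b, hR, rfl⟩ := h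
  obtain ⟨c, rfl⟩ := hP.extension i hi hR a
  exact ⟨c ≫ b, by simp⟩

variable (P)

/-- The morphisms inducing bijections on maps from objects in the given class, modulo the
morphisms that factor through a projective object. -/
def weq : MorphismProperty C := fun Y Z f => ∀ X, P X →
  (∀ z : X ⟶ Z, ∃ y : X ⟶ Y, IsNull (z - y ≫ f)) ∧ ∀ y : X ⟶ Y, IsNull (y ≫ f) → IsNull y

/-- Null maps are closed under sums and postcomposition, so Hom(T, -) modulo null maps is an
additive functor, and `weq` asks that it become surjective with trivial kernel for all T in `P`. -/
instance : (weq P).HasTwoOutOfThreeProperty where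
  comp_mem {X Y Z} f g hf hg T hT := by
    refine ⟨fun z => ?_, fun x hx => (hf T hT).2 _ ((hg T hT).2 _ (by simpa using hx))⟩
    obtain ⟨y, hy⟩ := (hg T hT).1 z
    obtain ⟨x, hx⟩ := (hf T hT).1 y
    refine ⟨x, ?_⟩
    convert hy.add (hx.comp g) using 1
    simp
  of_postcomp {X Y Z} f g hg hfg T hT := by
    refine ⟨fun y => ?_, fun x hx => (hfg T hT).2 _ (by simpa using hx.comp g)⟩
    obtain ⟨x, hx⟩ := (hfg T hT).1 (y ≫ g)
    exact ⟨x, (hg T hT).2 _ (by simpa using hx)⟩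
  of_precomp {X Y Z} f g hf hfg T hT := by
    refine ⟨fun z => ?_, fun y hy => ?_⟩
    · obtain ⟨x, hx⟩ := (hfg T hT).1 z
      exact ⟨x ≫ f, by simpa using hx⟩
    · obtain ⟨x, hx⟩ := (hf T hT).1 y
      have h₁ : IsNull (x ≫ f ≫ g) := by
        convert hy.sub (hx.comp g) using 1
        simp
      have h₂ := ((hfg T hT).2 _ h₁).comp f
      simpa using h₂.add hx

variable {P}

/-- The presentation of `cokernel i` has its kernel in `P`, and the inclusion of that kernel is
itself in `cof P`; null maps to `kernel f` therefore extend along it. -/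
lemma hasLiftingProperty_of_cof (hP : IsCofibrantClass P) {A B X Y : C} {i : A ⟶ B}
    (hi : cof P i) (f : X ⟶ Y) [Epi f]
    (h : ∀ Z, P Z → ∀ g : Z ⟶ kernel f, IsNull g) : HasLiftingProperty i f := by
  have : Mono i := hi.1
  have := hP.retract
  obtain ⟨Q, q, _, hq, hK⟩ := hP.presentation _ hi.2
  refine hasLiftingProperty_of_extension i f q fun k => (h _ hK k).exists_extension hP ⟨inferInstance, ?_⟩
  have e : cokernel (kernel.ι q) ≅ cokernel i :=
    IsColimit.coconePointUniqueUpToIso (colimit.isColimit _)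
      (Abelian.epiIsCokernelOfKernel _ (limit.isLimit _))
  exact P.prop_of_retract (Retract.ofIso e) hi.2

lemma cof_zero (hP : P.IsStableUnderRetracts) {X : C} (hX : P X) : cof P (0 : 0 ⟶ X) :=
  ⟨inferInstance, P.prop_of_retract (Retract.ofIso cokernelZeroIsoTarget) hX⟩

lemma epi_of_rlp_cof (hP : IsCofibrantClass P) {X Y : C} (f : X ⟶ Y) (hf : (cof P).rlp f) :
    Epi f := by
  have := hP.enoughProjectives
  have := hf _ (cof_zero hP.retract (hP.of_projective _ (Projective.projective_over Y)))
  have sq : CommSq (0 : 0 ⟶ X) (0 : 0 ⟶ Projective.over Y) f (Projective.π Y) := ⟨by simp⟩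
  have h := sq.fac_right
  exact epi_of_epi_fac h

/-- Surjectivity is lifting against `0 ⟶ T`. For injectivity, embed `T` in a projective `J`: a null
composite extends to `J`, and a lift factors `x` through `J`. -/
lemma weq_of_rlp_cof (hP : IsCofibrantClass P) {X Y : C} (f : X ⟶ Y) (hf : (cof P).rlp f) :
    weq P f := by
  intro T hT
  refine ⟨fun y => ?_, fun x hx => ?_⟩
  · have := hf _ (cof_zero hP.retract hT)
    have sq : CommSq (0 : 0 ⟶ X) (0 : 0 ⟶ T) f y := ⟨by simp⟩
    refine ⟨sq.lift, ?_⟩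
    rw [sq.fac_right, sub_self]
    exact isNull_zero
  · obtain ⟨J, ι, hJ, hι⟩ := hP.embedding T hT
    obtain ⟨y, hy⟩ := hx.exists_extension hP hι
    have := hf _ hι
    have sq : CommSq x ι f y := ⟨hy.symm⟩
    exact ⟨J, ι, sq.lift, hJ, sq.fac_left⟩

/-- By `hasLiftingProperty_of_cof` it suffices that maps `g` from `T` in `P` to `kernel f` are null.
Injectivity of `f` on stable maps extends `g` to a map from the projective `J` to `X`; surjectivity,
applied to `cokernel ι`, corrects this map so that it lands in `kernel f`. -/
lemma rlp_cof_of_weq (hP : IsCofibrantClass P) {X Y : C} (f : X ⟶ Y) [Epi f] (hf : weq P f) :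
    (cof P).rlp f := by
  intro A B i hi
  refine hasLiftingProperty_of_cof hP hi f fun T hT g => ?_
  obtain ⟨J, ι, hJ, hι⟩ := hP.embedding T hT
  have : Mono ι := hι.1
  obtain ⟨h, hh⟩ := ((hf T hT).2 (g ≫ kernel.ι f) (by simpa using isNull_zero)).exists_extension
    hP hι
  obtain ⟨h', hh'⟩ : ∃ h', cokernel.π ι ≫ h' = h ≫ f :=
    ⟨cokernel.desc ι (h ≫ f) (by rw [reassoc_of% hh, kernel.condition, comp_zero]),
      cokernel.π_desc _ _ _⟩
  obtain ⟨s, R, a, b, hR, hs⟩ := (hf _ hι.2).1 h'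
  let b' : R ⟶ X := Projective.factorThru b f
  have hb' : b' ≫ f = b := Projective.factorThru_comp _ _
  -- The subtracted term factors through `cokernel.π ι`, so `t` still restricts to `g ≫ kernel.ι f`.
  let t : J ⟶ X := h - cokernel.π ι ≫ (s + a ≫ b')
  have ht : t ≫ f = 0 := by
    simp only [t, Preadditive.sub_comp, Preadditive.add_comp, Category.assoc, hb', hs, ← hh']
    simp
  refine ⟨J, ι, kernel.lift f t ht, hJ, ?_⟩
  rw [← cancel_mono (kernel.ι f)]
  simp [t, hh]

lemma weq_inf_epi (hP : IsCofibrantClass P) :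
    MorphismProperty.epimorphisms C ⊓ weq P = (cof P).rlp := by
  ext X Y f
  refine ⟨fun ⟨h, h'⟩ => ?_, fun h => ⟨epi_of_rlp_cof hP f h, weq_of_rlp_cof hP f h⟩⟩
  have : Epi f := h
  exact rlp_cof_of_weq hP f h'

lemma factorization_llp_epi (hP : IsCofibrantClass P) :
    (MorphismProperty.epimorphisms C).llp.HasFactorization
      (MorphismProperty.epimorphisms C) where
  nonempty_mapFactorizationData {X Y} f := by
    have := hP.enoughProjectives
    exact ⟨{
      Z := X ⊞ Projective.over Y
      i := biprod.inl
      p := biprod.desc f (Projective.π Y)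
      fac := by simp
      hi := fun A B g (_ : Epi g) => ⟨fun {a b} sq => ⟨⟨{
        l := biprod.desc a (Projective.factorThru (biprod.inr ≫ b) g)
        fac_left := by simp
        fac_right := by
          ext
          · simp [sq.w]
          · simp }⟩⟩⟩
      hp := by
        have : Epi (biprod.inr ≫ biprod.desc f (Projective.π Y)) := by
          rw [biprod.inr_desc]; infer_instance
        exact epi_of_epi (biprod.inr : _ ⟶ X ⊞ Projective.over Y) _ }⟩

/-- Lifting against `A ⟶ 0` splits `i` by some `r`, and lifting against epimorphisms makes the
cokernel projective. Then `𝟙 B - r ≫ i` factors through this cokernel, so `r` is inverse to `i`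
modulo null maps. -/
lemma cof_weq_of_llp_epi (hP : IsCofibrantClass P) {A B : C} (i : A ⟶ B)
    (hi : (MorphismProperty.epimorphisms C).llp i) : cof P i ∧ weq P i := by
  have := hP.retract
  have := hi (0 : A ⟶ 0) (inferInstanceAs (Epi _))
  have sq : CommSq (𝟙 A) i (0 : A ⟶ 0) 0 := ⟨by simp⟩
  obtain ⟨r, hr⟩ : ∃ r : B ⟶ A, i ≫ r = 𝟙 A := ⟨sq.lift, sq.fac_left⟩
  have hm : Mono i := mono_of_mono_fac hr
  have hQ : Projective (cokernel i) := ⟨fun {E X} f e he => by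
    have := hi e he
    have sq : CommSq (0 : A ⟶ E) i e (cokernel.π i ≫ f) := ⟨by simp⟩
    refine ⟨cokernel.desc i sq.lift sq.fac_left, ?_⟩
    ext
    simp⟩
  refine ⟨⟨hm, hP.of_projective _ hQ⟩, fun T _ => ⟨fun z => ⟨z ≫ r, ?_⟩, fun y hy => ?_⟩⟩
  · obtain ⟨c, hc⟩ : ∃ c, cokernel.π i ≫ c = 𝟙 B - r ≫ i :=
      ⟨cokernel.desc i (𝟙 B - r ≫ i) (by simp [reassoc_of% hr]), cokernel.π_desc _ _ _⟩
    refine ⟨_, z ≫ cokernel.π i, c, hQ, ?_⟩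
    simp [hc]
  · simpa [hr] using hy.comp r

/-- Retract argument: factor `i` by `factorization_llp_epi`; two out of three makes the second
factor a trivial fibration, against which `i` lifts. -/
lemma cof_inf_weq (hP : IsCofibrantClass P) :
    cof P ⊓ weq P = (MorphismProperty.epimorphisms C).llp := by
  ext A B i
  refine ⟨fun ⟨h, h'⟩ => ?_, fun h => cof_weq_of_llp_epi hP i h⟩
  have := factorization_llp_epi hP
  have d := MorphismProperty.factorizationData (MorphismProperty.epimorphisms C).llp
    (MorphismProperty.epimorphisms C) i
  have : Epi d.p := d.hp
  have hw : weq P d.p := (weq P).of_precomp d.i d.p (cof_weq_of_llp_epi hP _ d.hi).2 (by rwa [d.fac])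
  have := rlp_cof_of_weq hP d.p hw i h
  exact MorphismProperty.of_retract (RetractArrow.ofLeftLiftingProperty d.fac) d.hi

lemma llp_rlp_cof (hP : IsCofibrantClass P) : (cof P).rlp.llp = cof P := by
  have := hP.factorization
  have := cof_isStableUnderRetracts hP.retract
  exact MorphismProperty.llp_eq_of_le_llp_of_hasFactorization_of_isStableUnderRetracts
    (MorphismProperty.le_llp_rlp _)

lemma isWeakFactorizationSystem_cof (hP : IsCofibrantClass P) :
    MorphismProperty.IsWeakFactorizationSystem (cof P)
      (MorphismProperty.epimorphisms C ⊓ weq P) := by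
  rw [weq_inf_epi hP]
  exact { rlp := rfl, llp := llp_rlp_cof hP, hasFactorization := hP.factorization }

lemma isWeakFactorizationSystem_epi (hP : IsCofibrantClass P) :
    MorphismProperty.IsWeakFactorizationSystem (cof P ⊓ weq P)
      (MorphismProperty.epimorphisms C) := by
  rw [cof_inf_weq hP]
  have := factorization_llp_epi hP
  exact { rlp := MorphismProperty.rlp_eq_of_le_rlp_of_hasFactorization_of_isStableUnderRetracts
            (MorphismProperty.le_llp_iff_le_rlp _ _ |>.1 le_rfl)
          llp := rfl
          hasFactorization := this }

end Lifting
end AbelianModel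

/-! ### Duality: the injective case through the opposite category -/

namespace AbelianModel

open scoped ZeroObject

section Opposite

variable {C : Type*} [Category C]

lemma rlp_unop (W : MorphismProperty Cᵒᵖ) : W.unop.rlp = W.llp.unop := by
  ext X Y f
  refine ⟨fun h A B g hg => ?_, fun h A B g hg => ?_⟩
  · exact (HasLiftingProperty.iff_unop _ _).2 (h g.unop hg)
  · exact (HasLiftingProperty.iff_op).2 (h g.op hg)

lemma llp_unop (W : MorphismProperty Cᵒᵖ) : W.unop.llp = W.rlp.unop := by
  ext X Y f
  refine ⟨fun h A B g hg => ?_, fun h A B g hg => ?_⟩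
  · exact (HasLiftingProperty.iff_unop _ _).2 (h g.unop hg)
  · exact (HasLiftingProperty.iff_op).2 (h g.op hg)

lemma isWeakFactorizationSystem_unop {W V : MorphismProperty Cᵒᵖ}
    (h : W.IsWeakFactorizationSystem V) : V.unop.IsWeakFactorizationSystem W.unop where
  rlp := by rw [rlp_unop, h.llp]
  llp := by rw [llp_unop, h.rlp]
  hasFactorization := ⟨fun f =>
    have := h.hasFactorization
    ⟨(MorphismProperty.factorizationData W V f.op).unop⟩⟩

lemma epimorphisms_unop :
    (MorphismProperty.epimorphisms Cᵒᵖ).unop = MorphismProperty.monomorphisms C := by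
  ext X Y f
  refine ⟨fun (h : Epi f.op) => ?_, fun (h : Mono f) => inferInstanceAs (Epi f.op)⟩
  exact inferInstanceAs (Mono f.op.unop)

variable [Abelian C] (P : ObjectProperty C)

/-- The conditions on a class of objects ensuring that it is the class of fibrant objects of an
injective abelian model structure. -/
structure IsFibrantClass : Prop where
  retract : P.IsStableUnderRetracts
  of_injective : ∀ X, Injective X → P X
  lifting : ∀ {X Y E : C} (f : X ⟶ Y), fib P f → Injective E → ∀ b : E ⟶ Y,
    ∃ a : E ⟶ X, a ≫ f = b
  presentation : ∀ X, P X → ∃ (Q : C) (π : Q ⟶ X), Injective Q ∧ fib P π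
  embedding : ∀ X, P X → ∃ (J : C) (ι : X ⟶ J), Injective J ∧ cof P ι
  enoughInjectives : EnoughInjectives C
  factorization : (fib P).llp.HasFactorization (fib P)

variable {P}

lemma cof_op_iff (hP : P.IsStableUnderRetracts) {X Y : Cᵒᵖ} (f : X ⟶ Y) :
    cof P.op f ↔ fib P f.unop := by
  refine and_congr ⟨fun _ => inferInstance, fun h => ?_⟩ ⟨fun h => ?_, fun h => ?_⟩
  · have : Mono f.unop.op := inferInstance
    exact this
  · exact P.prop_of_retract (Retract.ofIso (cokernelOpUnop f.unop).symm) h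
  · exact P.prop_of_retract (Retract.ofIso (cokernelOpUnop f.unop)) h

lemma fib_op_iff (hP : P.IsStableUnderRetracts) {X Y : Cᵒᵖ} (f : X ⟶ Y) :
    fib P.op f ↔ cof P f.unop := by
  refine and_congr ⟨fun _ => inferInstance, fun h => ?_⟩ ⟨fun h => ?_, fun h => ?_⟩
  · have : Epi f.unop.op := inferInstance
    exact this
  · exact P.prop_of_retract (Retract.ofIso (kernelOpUnop f.unop).symm) h
  · exact P.prop_of_retract (Retract.ofIso (kernelOpUnop f.unop)) h

lemma cof_op_unop (hP : P.IsStableUnderRetracts) : (cof P.op).unop = fib P := by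
  ext X Y f
  exact cof_op_iff hP f.op

/-- Under duality `embedding` and `presentation` trade places, as do `extension` and `lifting`. -/
lemma IsFibrantClass.op (hP : IsFibrantClass P) : IsCofibrantClass P.op where
  retract := ⟨fun {X Y} h hY => by
    have := hP.retract
    exact P.prop_of_retract
      { i := h.r.unop, r := h.i.unop, retract := Quiver.Hom.op_inj h.retract } hY⟩
  of_projective X _ := hP.of_injective X.unop inferInstance
  extension {A B E} i hi hE a := by
    obtain ⟨b, hb⟩ := hP.lifting i.unop ((cof_op_iff hP.retract i).1 hi)
      (inferInstanceAs (Injective E.unop)) a.unop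
    exact ⟨b.op, Quiver.Hom.unop_inj hb⟩
  embedding X hX := by
    obtain ⟨Q, π, h, hπ⟩ := hP.presentation X.unop hX
    exact ⟨_, π.op, inferInstance, (cof_op_iff hP.retract π.op).2 hπ⟩
  presentation X hX := by
    obtain ⟨Q, π, h, hπ⟩ := hP.embedding X.unop hX
    exact ⟨_, π.op, inferInstance, (fib_op_iff hP.retract π.op).2 hπ⟩
  enoughProjectives := by
    have := hP.enoughInjectives
    infer_instance
  factorization := by
    have := hP.factorization
    have h₁ : cof P.op = (fib P).op := by
      rw [← cof_op_unop hP.retract, MorphismProperty.op_unop]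
    have h₂ : (cof P.op).rlp = (fib P).llp.op := by
      rw [← cof_op_unop hP.retract, llp_unop, MorphismProperty.op_unop]
    rw [h₂, h₁]
    infer_instance

lemma isWeakFactorizationSystem_fib (hP : IsFibrantClass P) :
    MorphismProperty.IsWeakFactorizationSystem
      (MorphismProperty.monomorphisms C ⊓ (weq P.op).unop) (fib P) := by
  rw [← cof_op_unop hP.retract, ← epimorphisms_unop]
  exact isWeakFactorizationSystem_unop (isWeakFactorizationSystem_cof hP.op)

lemma isWeakFactorizationSystem_mono (hP : IsFibrantClass P) :
    MorphismProperty.IsWeakFactorizationSystem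
      (MorphismProperty.monomorphisms C) (fib P ⊓ (weq P.op).unop) := by
  rw [← cof_op_unop hP.retract, ← epimorphisms_unop]
  exact isWeakFactorizationSystem_unop (isWeakFactorizationSystem_epi hP.op)

end Opposite

/-! ### Assembly and uniqueness of the model structures -/

section Model

variable {C : Type*} [Category C]

/-- The model structure with given classes of cofibrations, fibrations and weak equivalences. -/
@[reducible]
def modelCategory [HasFiniteLimits C] [HasFiniteColimits C] (c f w : MorphismProperty C)
    (hw : w.HasTwoOutOfThreeProperty) (h : c.IsWeakFactorizationSystem (f ⊓ w))
    (h' : (c ⊓ w).IsWeakFactorizationSystem f) : ModelCategory C :=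
  letI : CategoryWithFibrations C := ⟨f⟩
  letI : CategoryWithCofibrations C := ⟨c⟩
  letI : CategoryWithWeakEquivalences C := ⟨w⟩
  have : (weakEquivalences C).HasTwoOutOfThreeProperty := hw
  have : (cofibrations C).IsWeakFactorizationSystem (trivialFibrations C) := h
  have : (trivialCofibrations C).IsWeakFactorizationSystem (fibrations C) := h'
  ModelCategory.mk' C

/-- Cofibrations and fibrations determine the weak equivalences, because the trivial ones are given
by lifting properties. This is the source of uniqueness. -/
lemma weakEquivalences_eq [ModelCategory C] {X Y : C} (f : X ⟶ Y) :
    weakEquivalences C f ↔ ∃ (Z : C) (i : X ⟶ Z) (p : Z ⟶ Y),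
      (fibrations C).llp i ∧ (cofibrations C).rlp p ∧ i ≫ p = f := by
  constructor
  · intro h
    have d := MorphismProperty.factorizationData (cofibrations C) (trivialFibrations C) f
    refine ⟨d.Z, d.i, d.p, ?_, ?_, d.fac⟩
    · rw [MorphismProperty.llp_eq_of_wfs (trivialCofibrations C) (fibrations C)]
      exact ⟨d.hi, (weakEquivalences C).of_postcomp d.i d.p d.hp.2 (by rwa [d.fac])⟩
    · rw [MorphismProperty.rlp_eq_of_wfs (cofibrations C) (trivialFibrations C)]
      exact d.hp
  · rintro ⟨Z, i, p, hi, hp, rfl⟩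
    rw [MorphismProperty.llp_eq_of_wfs (trivialCofibrations C) (fibrations C)] at hi
    rw [MorphismProperty.rlp_eq_of_wfs (cofibrations C) (trivialFibrations C)] at hp
    exact (weakEquivalences C).comp_mem _ _ hi.2 hp.2

lemma modelCategory_ext (M M' : ModelCategory C)
    (hc : M.categoryWithCofibrations = M'.categoryWithCofibrations)
    (hf : M.categoryWithFibrations = M'.categoryWithFibrations) : M = M' := by
  have hw : M.categoryWithWeakEquivalences = M'.categoryWithWeakEquivalences := by
    refine congr_arg CategoryWithWeakEquivalences.mk (?_ :
      M.categoryWithWeakEquivalences.weakEquivalences =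
        M'.categoryWithWeakEquivalences.weakEquivalences)
    ext X Y f
    have h₁ := @weakEquivalences_eq C _ M _ _ f
    have h₂ := @weakEquivalences_eq C _ M' _ _ f
    unfold cofibrations fibrations at h₁ h₂
    rw [hc, hf] at h₁
    exact h₁.trans h₂.symm
  cases M
  cases M'
  subst hc hf hw
  rfl

variable [Abelian C] {P : ObjectProperty C}

lemma cof_zero_iff (hP : P.IsStableUnderRetracts) {Z X : C} (hZ : IsZero Z) (f : Z ⟶ X) :
    cof P f ↔ P X := by
  obtain rfl : f = 0 := hZ.eq_of_src _ _
  have : Mono (0 : Z ⟶ X) := ⟨fun _ _ _ => hZ.eq_of_tgt _ _⟩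
  exact ⟨fun h => P.prop_of_retract (Retract.ofIso cokernelZeroIsoTarget.symm) h.2,
    fun h => ⟨this, P.prop_of_retract (Retract.ofIso cokernelZeroIsoTarget) h⟩⟩

lemma fib_zero_iff (hP : P.IsStableUnderRetracts) {Z X : C} (hZ : IsZero Z) (f : X ⟶ Z) :
    fib P f ↔ P X := by
  obtain rfl : f = 0 := hZ.eq_of_tgt _ _
  have : Epi (0 : X ⟶ Z) := ⟨fun _ _ _ => hZ.eq_of_src _ _⟩
  exact ⟨fun h => P.prop_of_retract (Retract.ofIso kernelZeroIsoSource.symm) h.2,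
    fun h => ⟨this, P.prop_of_retract (Retract.ofIso kernelZeroIsoSource) h⟩⟩

/-- The projective abelian model structures with a given class of cofibrant objects are those whose
cofibrations are the monomorphisms with cokernel in the class and whose fibrations are the
epimorphisms. -/
lemma isProjectiveAbelianModel_iff (hP : P.IsStableUnderRetracts) (M : ModelCategory C) :
    (CDG.IsProjectiveAbelianModel M ∧ ∀ X : C, IsCofibrant X ↔ P X) ↔
      cofibrations C = cof P ∧ fibrations C = MorphismProperty.epimorphisms C := by
  constructor
  · rintro ⟨⟨h, h'⟩, h''⟩
    constructor
    · ext X Y f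
      rw [← cofibration_iff, h.cofibration_iff, h'']
      rfl
    · ext X Y f
      rw [← fibration_iff, h.fibration_iff]
      exact and_iff_left (h' _)
  · rintro ⟨h, h'⟩
    have h₁ : ∀ X : C, IsCofibrant X ↔ P X := fun X => by
      rw [isCofibrant_iff, cofibration_iff, h]
      exact cof_zero_iff hP (isZero_zero C |>.of_iso (initialIsInitial.uniqueUpToIso
        HasZeroObject.zeroIsInitial)) _
    have h₂ : ∀ X : C, IsFibrant X := fun X => by
      rw [isFibrant_iff, fibration_iff, h']
      have := isZero_zero C |>.of_iso (terminalIsTerminal.uniqueUpToIso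
        HasZeroObject.zeroIsTerminal)
      exact ⟨fun _ _ _ => this.eq_of_src _ _⟩
    refine ⟨⟨⟨fun f => ?_, fun f => ?_⟩, h₂⟩, h₁⟩
    · rw [h₁, cofibration_iff, h]
      rfl
    · rw [fibration_iff, h']
      exact (and_iff_left (h₂ _)).symm

/-- The injective abelian model structures with a given class of fibrant objects are those whose
cofibrations are the monomorphisms and whose fibrations are the epimorphisms with kernel in the
class. -/
lemma isInjectiveAbelianModel_iff (hP : P.IsStableUnderRetracts) (M : ModelCategory C) :
    (CDG.IsInjectiveAbelianModel M ∧ ∀ X : C, IsFibrant X ↔ P X) ↔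
      cofibrations C = MorphismProperty.monomorphisms C ∧ fibrations C = fib P := by
  constructor
  · rintro ⟨⟨h, h'⟩, h''⟩
    constructor
    · ext X Y f
      rw [← cofibration_iff, h.cofibration_iff]
      exact and_iff_left (h' _)
    · ext X Y f
      rw [← fibration_iff, h.fibration_iff, h'']
      rfl
  · rintro ⟨h, h'⟩
    have h₁ : ∀ X : C, IsFibrant X ↔ P X := fun X => by
      rw [isFibrant_iff, fibration_iff, h']
      exact fib_zero_iff hP (isZero_zero C |>.of_iso (terminalIsTerminal.uniqueUpToIso
        HasZeroObject.zeroIsTerminal)) _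
    have h₂ : ∀ X : C, IsCofibrant X := fun X => by
      rw [isCofibrant_iff, cofibration_iff, h]
      have := isZero_zero C |>.of_iso (initialIsInitial.uniqueUpToIso
        HasZeroObject.zeroIsInitial)
      exact ⟨fun _ _ _ => this.eq_of_tgt _ _⟩
    refine ⟨⟨⟨fun f => ?_, fun f => ?_⟩, h₂⟩, h₁⟩
    · rw [cofibration_iff, h]
      exact (and_iff_left (h₂ _)).symm
    · rw [h₁, fibration_iff, h']
      rfl

lemma existsUnique_of_cofibrations_of_fibrations (c f w : MorphismProperty C)
    (hw : w.HasTwoOutOfThreeProperty) (h : c.IsWeakFactorizationSystem (f ⊓ w))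
    (h' : (c ⊓ w).IsWeakFactorizationSystem f) :
    ∃! _ : ModelCategory C, cofibrations C = c ∧ fibrations C = f := by
  refine ⟨modelCategory c f w hw h h', ⟨rfl, rfl⟩, fun _ ⟨hc, hf⟩ => modelCategory_ext _ _ ?_ ?_⟩
  · exact congr_arg CategoryWithCofibrations.mk hc
  · exact congr_arg CategoryWithFibrations.mk hf

theorem existsUnique_projective (hP : IsCofibrantClass P) :
    ∃! M : ModelCategory C, CDG.IsProjectiveAbelianModel M ∧ ∀ X : C, IsCofibrant X ↔ P X := by
  simp only [isProjectiveAbelianModel_iff hP.retract]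
  exact existsUnique_of_cofibrations_of_fibrations _ _ (weq P) inferInstance
    (isWeakFactorizationSystem_cof hP) (isWeakFactorizationSystem_epi hP)

theorem existsUnique_injective (hP : IsFibrantClass P) :
    ∃! M : ModelCategory C, CDG.IsInjectiveAbelianModel M ∧ ∀ X : C, IsFibrant X ↔ P X := by
  simp only [isInjectiveAbelianModel_iff hP.retract]
  exact existsUnique_of_cofibrations_of_fibrations _ _ (weq P.op).unop inferInstance
    (isWeakFactorizationSystem_mono hP) (isWeakFactorizationSystem_fib hP)

end Model

end AbelianModel

/-! ### Signs, shifts and contractible modules -/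

namespace CDG

section Sign

lemma map_sign_smul {M N : Type*} [AddCommGroup M] [AddCommGroup N] (f : M →+ N) (s : ℤˣ) (x : M) :
    f (s • x) = s • f x := by
  simp [Units.smul_def]

variable {Γ : Type u} [AddCommGroup Γ] (G : GradingGroup Γ)

lemma GradingGroup.sign_add (p q : Γ) : G.sign (p + q) = G.sign p * G.sign q := by
  simp [GradingGroup.sign, uzpow_add]

lemma GradingGroup.sign_zero : G.sign 0 = 1 := by
  simp [GradingGroup.sign]

lemma GradingGroup.sign_one : G.sign G.one = -1 := by
  simp [GradingGroup.sign, G.parity_one]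

lemma GradingGroup.sign_eq (p : Γ) : G.sign p = 1 ∨ G.sign p = -1 :=
  Int.units_eq_one_or _

end Sign

variable {Γ : Type u} [AddCommGroup Γ] [DecidableEq Γ] {G : GradingGroup Γ} {A : Type u} [Ring A]
  {𝒜 : Γ → AddSubgroup A} [GradedRing 𝒜]

/-! ### Graded modules -/

namespace GrMod

@[ext]
lemma hom_ext {X Y : GrMod 𝒜} {φ ψ : X ⟶ Y} (h : ∀ n x, φ.f n x = ψ.f n x) : φ = ψ :=
  GrMod.Hom.ext (funext fun n => AddMonoidHom.ext (h n))

@[simp]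
lemma comp_f {X Y Z : GrMod 𝒜} (φ : X ⟶ Y) (ψ : Y ⟶ Z) (n : Γ) (x : X.X n) :
    (φ ≫ ψ).f n x = ψ.f n (φ.f n x) := rfl

lemma congr_f {X Y : GrMod 𝒜} {φ ψ : X ⟶ Y} (h : φ = ψ) (n : Γ) (x : X.X n) :
    φ.f n x = ψ.f n x := by
  rw [h]

lemma mono_of_injective {X Y : GrMod 𝒜} (φ : X ⟶ Y) (h : ∀ n, Function.Injective (φ.f n)) :
    Mono φ :=
  ⟨fun _ _ e => hom_ext fun n x => h n (congr_f e n x)⟩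

lemma epi_of_surjective {X Y : GrMod 𝒜} (φ : X ⟶ Y) (h : ∀ n, Function.Surjective (φ.f n)) :
    Epi φ :=
  ⟨fun _ _ e => hom_ext fun n y => by
    obtain ⟨x, rfl⟩ := h n y
    exact congr_f e n x⟩

variable (M : GrMod 𝒜)

/-- Degrees often agree only propositionally. This lemma and the following ones compare actions
through their values in `A`, so that no transport along equalities appears. -/
lemma act_congr {p p' q r : Γ} (h : p + q = r) (h' : p' + q = r) (a : 𝒜 p) (a' : 𝒜 p')
    (ha : (a : A) = a') (x : M.X q) : M.act h a x = M.act h' a' x := by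
  obtain rfl : p = p' := add_right_cancel (h.trans h'.symm)
  obtain rfl : a = a' := Subtype.ext ha
  rfl

lemma act_act {p p' p'' q r s : Γ} (h : p' + q = r) (h' : p + r = s) (h'' : p'' + q = s)
    (a : 𝒜 p) (b : 𝒜 p') (c : 𝒜 p'') (hc : (c : A) = a * b) (x : M.X q) :
    M.act h' a (M.act h b x) = M.act h'' c x := by
  rw [← M.mul_act h h']
  exact M.act_congr _ _ _ _ hc.symm _

lemma act_eq_zero {p q r : Γ} (h : p + q = r) (a : 𝒜 p) (ha : (a : A) = 0) (x : M.X q) :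
    M.act h a x = 0 := by
  obtain rfl : a = 0 := Subtype.ext ha
  simp

/-- The identification of two components of a graded module with equal indices. -/
def castHom {n m : Γ} (h : n = m) : M.X n →+ M.X m :=
  M.act (p := 0) (by rw [zero_add, h]) ⟨1, SetLike.GradedOne.one_mem⟩

@[simp]
lemma castHom_rfl {n : Γ} (h : n = n) (x : M.X n) : M.castHom h x = x := M.one_act x

@[simp]
lemma castHom_castHom {n m k : Γ} (h : n = m) (h' : m = k) (x : M.X n) :
    M.castHom h' (M.castHom h x) = M.castHom (h.trans h') x := by
  subst h h'
  simp

lemma castHom_act {p q r r' : Γ} (h : p + q = r) (h' : r = r') (a : 𝒜 p) (x : M.X q) :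
    M.castHom h' (M.act h a x) = M.act (h.trans h') a x := by
  subst h'
  simp

lemma act_castHom {p q q' r : Γ} (h : q = q') (h' : p + q' = r) (a : 𝒜 p) (x : M.X q) :
    M.act h' a (M.castHom h x) = M.act (by rw [h, h']) a x := by
  subst h
  simp

variable {M} in
lemma f_castHom {N : GrMod 𝒜} (φ : M ⟶ N) {n m : Γ} (h : n = m) (x : M.X n) :
    φ.f m (M.castHom h x) = N.castHom h (φ.f n x) :=
  φ.map_act _ _ _

/-- The shift of graded modules, with the action twisted by a sign. -/
def shift (G : GradingGroup Γ) (g : Γ) : GrMod 𝒜 ⥤ GrMod 𝒜 where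
  obj M :=
    { X n := M.X (n + g)
      act {p q r} h := G.sign p • M.act (p := p) (q := q + g) (r := r + g) (by rw [← add_assoc, h])
      one_act x := by
        rw [G.sign_zero, one_smul]
        exact M.castHom_rfl rfl x
      mul_act {p p' q r s} h h' a b x := by
        simp only [AddMonoidHom.smul_apply, map_sign_smul]
        rw [M.act_act _ _ (p'' := p + p') (by rw [← h', ← h]; abel) a b
          ⟨a * b, SetLike.GradedMul.mul_mem a.2 b.2⟩ rfl, G.sign_add, mul_comm, mul_smul] }
  map φ :=
    { f n := φ.f (n + g)
      map_act h a x := by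
        simp [φ.map_act] }

/-- Shifting by `g` and then by `g'` with `g + g' = 0` is isomorphic to the identity. -/
def shiftShiftIso (G : GradingGroup Γ) (g g' : Γ) (h : g + g' = 0) :
    𝟭 (GrMod 𝒜) ≅ shift G g ⋙ shift G g' :=
  have h' : ∀ n, n = n + g' + g := fun n => by rw [add_assoc, add_comm g', h, add_zero]
  -- The twist `G.sign p` does not depend on the shift, so two shifts cancel it whatever the parity
  -- of `g`.
  have hs : ∀ (p : Γ) {N : Type u} [AddCommGroup N] (x : N), G.sign p • G.sign p • x = x :=
    fun p N _ x => by rw [smul_smul, ← sq, Int.units_sq, one_smul]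
  NatIso.ofComponents (fun M =>
    { hom :=
        { f n := M.castHom (h' n)
          map_act h a x := by
            change M.castHom _ (M.act h a x) =
              G.sign _ • G.sign _ • M.act _ a (M.castHom (h' _) x)
            rw [hs, castHom_act, act_castHom] }
      inv :=
        { f n := M.castHom (h' n).symm
          map_act {p q r} h a (x : M.X (q + g' + g)) := by
            change M.castHom (h' _).symm (G.sign _ • G.sign _ • M.act (by rw [← h' _, h, ← h' _]) a x) =
              M.act h a (M.castHom (h' _).symm x)
            rw [hs, castHom_act, act_castHom] }
      hom_inv_id := hom_ext fun n x =>
        (M.castHom_castHom (h' n) (h' n).symm x).trans (M.castHom_rfl rfl x)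
      inv_hom_id := hom_ext fun n x =>
        (M.castHom_castHom (h' n).symm (h' n) x).trans (M.castHom_rfl rfl x) })
    (fun φ => hom_ext fun n x => (f_castHom φ (h' n) x).symm)

/-- The shift is an equivalence. -/
def shiftEquivalence (G : GradingGroup Γ) (g : Γ) : GrMod 𝒜 ≌ GrMod 𝒜 :=
  .mk (shift G g) (shift G (-g)) (shiftShiftIso G g (-g) (add_neg_cancel g))
    (shiftShiftIso G (-g) g (neg_add_cancel g)).symm

instance (G : GradingGroup Γ) (g : Γ) : (shift (𝒜 := 𝒜) G g).IsEquivalence :=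
  (shiftEquivalence G g).isEquivalence_functor

end GrMod

/-- The product of homogeneous elements. -/
def gmul {p p' p'' : Γ} (h : p + p' = p'') (a : 𝒜 p) (b : 𝒜 p') : 𝒜 p'' :=
  ⟨a * b, by
    subst h
    exact SetLike.GradedMul.mul_mem a.2 b.2⟩

@[simp] lemma coe_gmul {p p' p'' : Γ} (h : p + p' = p'') (a : 𝒜 p) (b : 𝒜 p') :
    (gmul h a b : A) = a * b := rfl

lemma GrMod.act_gmul (M : GrMod 𝒜) {p p' p'' q r s : Γ} (h : p' + q = r) (h' : p + r = s)
    (h'' : p'' + q = s) (hp : p + p' = p'') (a : 𝒜 p) (b : 𝒜 p') (x : M.X q) :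
    M.act h'' (gmul hp a b) x = M.act h' a (M.act h b x) :=
  (M.act_act h h' h'' a b _ rfl x).symm

namespace CDGStructure

variable (D : CDGStructure G 𝒜)

lemma d_one : D.d 1 = 0 := by
  have h := D.leibniz (SetLike.GradedOne.one_mem (A := 𝒜)) 1
  simpa [G.sign_zero] using h

/-- The differential as a map between homogeneous components. -/
def dHom (p : Γ) : 𝒜 p →+ 𝒜 (p + G.one) :=
  (D.d.comp (𝒜 p).subtype).codRestrict _ (fun a => D.d_mem a.2)

@[simp] lemma coe_dHom {p : Γ} (a : 𝒜 p) : (D.dHom p a : A) = D.d a := rfl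

/-- The curvature element as an element of its homogeneous component. -/
def curv : 𝒜 (G.one + G.one) := ⟨D.w, D.w_mem⟩

@[simp] lemma coe_curv : (D.curv : A) = D.w := rfl

end CDGStructure

/-- With arbitrary proofs of the index equalities the Leibniz rule can be used for rewriting. -/
lemma CDGMod.leibniz' {D : CDGStructure G 𝒜} (X : CDGMod D) {p q r s t : Γ} (h : p + q = r)
    (h' : r + G.one = s) (h₁ : p + G.one + q = s) (h₂ : q + G.one = t) (h₃ : p + t = s)
    (a : 𝒜 p) (x : X.X q) :
    X.d h' (X.act h a x) = X.act h₁ (D.dHom p a) x + G.sign p • X.act h₃ a (X.d h₂ x) := by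
  subst h₂
  exact X.leibniz h h' a x

lemma CDGMod.d_castHom {D : CDGStructure G 𝒜} (X : CDGMod D) {n n' m : Γ} (h : n = n')
    (h' : n' + G.one = m) (x : X.X n) :
    X.d h' (X.castHom h x) = X.d (by rw [h, h']) x := by
  subst h
  simp

/-! ### The contractible cdg module on a graded module -/

variable (D : CDGStructure G 𝒜)

/-- The contractible cdg module on a graded module. -/
def cone (M : GrMod 𝒜) : CDGMod D where
  -- A pair `(x, y)` stands for the values of a graded map at an element and at its differential;
  -- the Leibniz rule and `d² = w` then force the action and `d (x, y) = (y, w x)`.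
  X n := M.X n × M.X (n + G.one)
  act {p q r} h := AddMonoidHom.mk' (fun a => AddMonoidHom.mk' (fun x => (M.act h a x.1,
      M.act (p := p + G.one) (q := q) (r := r + G.one) (by rw [add_right_comm, h])
        (D.dHom p a) x.1 +
      G.sign p • M.act (p := p) (q := q + G.one) (r := r + G.one) (by rw [← add_assoc, h]) a x.2))
      (fun x y => by
        ext
        · simp
        · simp only [Prod.fst_add, Prod.snd_add, map_add, smul_add]; abel))
      (fun a b => by
        ext x
        · simp
        · simp only [AddMonoidHom.mk'_apply, AddMonoidHom.add_apply, Prod.snd_add, map_add,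
            smul_add]
          abel)
  one_act x := by
    refine Prod.ext (M.one_act _) ?_
    change M.act _ (D.dHom 0 ⟨1, _⟩) x.1 + G.sign 0 • M.act _ ⟨1, _⟩ x.2 = x.2
    rw [M.act_eq_zero _ _ D.d_one, G.sign_zero, one_smul, zero_add]
    exact M.castHom_rfl rfl x.2
  mul_act {p p' q r s} h h' a b x := by
    refine Prod.ext (M.mul_act h h' a b x.1) ?_
    have e₁ : D.dHom (p + p') (gmul rfl a b) =
        gmul (add_right_comm _ _ _) (D.dHom p a) b +
          G.sign p • gmul (add_assoc _ _ _).symm a (D.dHom p' b) :=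
      Subtype.ext (by simp [D.leibniz a.2, Units.smul_def])
    change M.act _ (D.dHom (p + p') (gmul rfl a b)) x.1 +
        G.sign (p + p') • M.act _ (gmul rfl a b) x.2 =
      M.act _ (D.dHom p a) (M.act h b x.1) + G.sign p • M.act _ a (M.act _ (D.dHom p' b) x.1 +
        G.sign p' • M.act _ b x.2)
    rw [e₁]
    simp only [map_add, map_sign_smul, AddMonoidHom.add_apply, AddMonoidHom.smul_apply, smul_add]
    rw [M.act_gmul h (by rw [add_right_comm, h']), M.act_gmul (p' := p' + G.one) (r := r + G.one)
        (by rw [add_right_comm, h]) (by rw [← add_assoc, h']),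
      M.act_gmul (q := q + G.one) (r := r + G.one) (by rw [← add_assoc, h])
        (by rw [← add_assoc, h']), G.sign_add, mul_smul, add_assoc]
  d {n m} h := AddMonoidHom.mk' (fun x => (M.castHom h x.2,
      M.act (p := G.one + G.one) (by rw [← h]; abel) D.curv x.1)) (fun x y => by ext <;> simp)
  leibniz {p q r s} h h' a x := by
    subst h'
    refine Prod.ext ?_ ?_
    · change M.castHom _ (M.act _ (D.dHom p a) x.1 + G.sign p • M.act _ a x.2) =
        M.act _ (D.dHom p a) x.1 + G.sign p • M.act _ a (M.castHom _ x.2)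
      rw [M.castHom_rfl, M.castHom_rfl]
    · change M.act _ D.curv (M.act h a x.1) = (M.act _ (D.dHom _ (D.dHom p a)) x.1 +
        G.sign (p + G.one) • M.act _ (D.dHom p a) x.2) + G.sign p • (
          M.act _ (D.dHom p a) (M.castHom _ x.2) + G.sign p • M.act _ a (M.act _ D.curv x.1))
      -- The curvature identity `d² a = w a - a w` accounts for the terms in `x.1`; the two terms
      -- `(d a) x.2` have opposite signs and cancel.
      have e₂ : D.dHom _ (D.dHom p a) = gmul (by abel) D.curv a - gmul (add_assoc _ _ _).symm a D.curv :=
        Subtype.ext (by simp [D.d_d])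
      rw [e₂, map_sub, AddMonoidHom.sub_apply, M.act_gmul h (by rw [add_comm, add_assoc]),
        M.act_gmul (p' := G.one + G.one) (r := q + G.one + G.one) (by abel) (by rw [← h]; abel),
        G.sign_add, G.sign_one, M.castHom_rfl]
      rcases G.sign_eq p with hp | hp <;> simp [hp]
  d_d {n m k} h h' x := by
    subst h h'
    refine Prod.ext ?_ ?_
    · change M.castHom _ (M.act _ D.curv x.1) = M.act _ D.curv x.1
      rw [M.castHom_rfl]
    · change M.act _ D.curv (M.castHom _ x.2) = M.act _ (D.dHom _ D.curv) x.1 +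
        G.sign (G.one + G.one) • M.act _ D.curv x.2
      rw [M.castHom_rfl, M.act_eq_zero _ (D.dHom _ D.curv) D.d_w, G.sign_add, G.sign_one]
      simp
end CDG

/-! ### The adjunctions `forget ⊣ coneFunctor ⊣ shiftForget` -/

namespace CDG

variable {Γ : Type u} [AddCommGroup Γ] [DecidableEq Γ] {G : GradingGroup Γ} {A : Type u} [Ring A]
  {𝒜 : Γ → AddSubgroup A} [GradedRing 𝒜] (D : CDGStructure G 𝒜)

open CDGMod GrMod

/-- The contractible cdg module on a graded module, as a functor. -/
def coneFunctor : GrMod 𝒜 ⥤ CDGMod D where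
  obj M := cone D M
  map {M N} φ := ({
    f n := (φ.f n).prodMap (φ.f (n + G.one))
    map_act {p q r} h a (x : M.X q × M.X (q + G.one)) := by
      refine Prod.ext (φ.map_act h a x.1) ?_
      change φ.f _ (M.act _ (D.dHom p a) x.1 + G.sign p • M.act _ a x.2) =
        N.act _ (D.dHom p a) (φ.f _ x.1) + G.sign p • N.act _ a (φ.f _ x.2)
      rw [map_add, map_sign_smul, φ.map_act, φ.map_act]
    comm {n m} h (x : M.X n × M.X (n + G.one)) := Prod.ext (f_castHom φ h x.2) (φ.map_act _ _ _) } : CDGMod.Hom _ _)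

variable {D}

/-- The morphism to a contractible module induced by a morphism of graded modules. -/
def toCone {X : CDGMod D} {M : GrMod 𝒜} (φ : X.toGrMod ⟶ M) : X ⟶ (coneFunctor D).obj M :=
  ({ f n := (φ.f n).prod ((φ.f (n + G.one)).comp (X.d rfl))
     map_act {p q r} h a x := by
      refine Prod.ext (φ.map_act h a x) ?_
      change φ.f _ (X.d rfl (X.act h a x)) = M.act _ (D.dHom p a) (φ.f _ x) +
        G.sign p • M.act _ a (φ.f _ (X.d rfl x))
      rw [X.leibniz' h rfl (by rw [add_right_comm, h]) rfl (by rw [← add_assoc, h]), map_add,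
        map_sign_smul]
      congr 1
      · exact φ.map_act _ _ _
      · exact congr_arg _ (φ.map_act _ _ _)
     comm {n m} h x := by
      subst h
      refine Prod.ext ?_ ?_
      · exact (M.castHom_rfl rfl _).symm
      · change φ.f _ (X.d rfl (X.d rfl x)) = M.act _ D.curv (φ.f _ x)
        rw [X.d_d]
        exact φ.map_act _ _ _ } : CDGMod.Hom _ _)

variable (D) in
/-- The contractible cdg modules are cofree. -/
def forgetAdjunction : forget D ⊣ coneFunctor D :=
  Adjunction.mkOfHomEquiv
    { homEquiv X M :=
        { toFun := toCone
          invFun (ψ : X ⟶ cone D M) :=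
            { f := fun n => (AddMonoidHom.fst _ _).comp (ψ.f n)
              map_act := fun h a x => congr_arg Prod.fst (ψ.map_act h a x) }
          left_inv _ := rfl
          right_inv (ψ : X ⟶ cone D M) := CDGMod.hom_ext fun _ x => Prod.ext rfl
            ((congr_arg Prod.fst (ψ.comm rfl x)).trans (M.castHom_rfl rfl _)) }
      homEquiv_naturality_left_symm _ _ := rfl
      homEquiv_naturality_right _ _ := rfl }

variable (D) in
/-- The shifted forgetful functor. -/
def shiftForget : CDGMod D ⥤ GrMod 𝒜 := forget D ⋙ shift G (-G.one)

/-- The morphism from a contractible module induced by a family of maps of degree `-1`. -/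
def ofConeAux {M : GrMod 𝒜} {X : CDGMod D} (g : ∀ n, M.X n →+ X.X (n + -G.one))
    (hg : ∀ {p q r : Γ} (h : p + q = r) (a : 𝒜 p) (x : M.X q), g r (M.act h a x) =
      G.sign p • X.act (p := p) (by rw [← add_assoc, h]) a (g q x)) :
    (coneFunctor D).obj M ⟶ X :=
  -- The pair `(x, y)` goes to `d (g x) + g y`. The first term is forced, since `(x, 0)` is the
  -- differential of `x` placed in the second summand one degree lower.
  ({ f n := AddMonoidHom.coprod ((X.d (neg_add_cancel_right n G.one)).comp (g n))
        ((X.castHom (add_neg_cancel_right n G.one)).comp (g (n + G.one)))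
     map_act {p q r} h a (x : M.X q × M.X (q + G.one)) := by
      change X.d _ (g _ (M.act h a x.1)) + X.castHom _ (g _ (M.act _ (D.dHom p a) x.1 +
        G.sign p • M.act _ a x.2)) =
        X.act h a (X.d _ (g _ x.1) + X.castHom _ (g _ x.2))
      rw [map_add, map_sign_smul, hg, hg, hg, map_sign_smul,
        X.leibniz' _ _ (by rw [← h]; abel) (neg_add_cancel_right q G.one) h, map_add, map_sign_smul,
        map_sign_smul, map_sign_smul, castHom_act, castHom_act, map_add, act_castHom, G.sign_add,
        G.sign_one]
      rcases G.sign_eq p with hp | hp <;> simp [hp] <;> abel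
     comm {n m} h (x : M.X n × M.X (n + G.one)) := by
      subst h
      change X.d _ (g _ (M.castHom _ x.2)) + X.castHom _ (g _ (M.act _ D.curv x.1)) =
        X.d rfl (X.d _ (g _ x.1) + X.castHom _ (g _ x.2))
      rw [M.castHom_rfl, hg, map_sign_smul, castHom_act, G.sign_add,
        G.sign_one, map_add, X.d_castHom, X.d_d]
      simp only [mul_neg, mul_one, neg_neg, one_smul]
      exact add_comm _ _ } : CDGMod.Hom _ _)

/-- The morphism from a contractible module induced by a morphism of graded modules. -/
def ofCone {M : GrMod 𝒜} {X : CDGMod D} (ψ : M ⟶ (shiftForget D).obj X) :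
    (coneFunctor D).obj M ⟶ X :=
  ofConeAux ψ.f ψ.map_act

variable (D) in
/-- The inclusion of the first summand. -/
def coneInl (M : GrMod 𝒜) (n : Γ) : M.X n →+ (cone D M).X n := AddMonoidHom.inl _ _

variable (D) in
/-- The inclusion of the second summand. -/
def coneInr (M : GrMod 𝒜) (n : Γ) : M.X (n + G.one) →+ (cone D M).X n := AddMonoidHom.inr _ _

lemma cone_act_inr (M : GrMod 𝒜) {p q r : Γ} (h : p + q = r) (a : 𝒜 p) (x : M.X (q + G.one)) :
    (cone D M).act h a (coneInr D M q x) =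
      G.sign p • coneInr D M r (M.act (by rw [← add_assoc, h]) a x) := by
  rw [← map_sign_smul]
  exact Prod.ext (map_zero (M.act h a)) ((congr_arg₂ _ (map_zero _) rfl).trans (zero_add _))

/-- The second summand therefore generates the contractible module, and a cdg morphism out of it is
determined there. -/
lemma cone_d_inr (M : GrMod 𝒜) {n m : Γ} (h : n + G.one = m) (x : M.X (n + G.one)) :
    (cone D M).d h (coneInr D M n x) = coneInl D M m (M.castHom h x) :=
  Prod.ext rfl (map_zero _)

lemma coneInl_add_coneInr (M : GrMod 𝒜) {n : Γ} (x : M.X n × M.X (n + G.one)) :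
    coneInl D M n x.1 + coneInr D M n x.2 = x :=
  Prod.ext (add_zero _) (zero_add _)

lemma cone_map_act_inr {M : GrMod 𝒜} {X : CDGMod D} (φ : cone D M ⟶ X) {p q r q' r' : Γ}
    (h : p + q = r) (hq : q = q' + G.one) (hr : r = r' + G.one) (h' : p + q' = r') (a : 𝒜 p)
    (x : M.X q) : φ.f r' (coneInr D M r' (M.castHom hr (M.act h a x))) =
      G.sign p • X.act h' a (φ.f q' (coneInr D M q' (M.castHom hq x))) := by
  subst hq hr
  rw [M.castHom_rfl, M.castHom_rfl, ← φ.map_act, cone_act_inr, map_sign_smul, smul_smul, ← sq,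
    Int.units_sq, one_smul]

lemma cone_map_castHom {M : GrMod 𝒜} {X : CDGMod D} (φ : cone D M ⟶ X) {n m : Γ} (h : n = m)
    (x : M.X (m + G.one)) : X.castHom h (φ.f n (coneInr D M n (M.castHom (by rw [h]) x))) =
      φ.f m (coneInr D M m x) := by
  subst h
  rw [X.castHom_rfl, M.castHom_rfl]

lemma cone_map_d {M : GrMod 𝒜} {X : CDGMod D} (φ : cone D M ⟶ X) {n m : Γ} (h : n + G.one = m)
    (x : M.X m) : X.d h (φ.f n (coneInr D M n (M.castHom h.symm x))) =
      φ.f m (coneInl D M m x) := by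
  subst h
  rw [← φ.comm, M.castHom_rfl, cone_d_inr, M.castHom_rfl]

lemma ofCone_inr {M : GrMod 𝒜} {X : CDGMod D} (ψ : M ⟶ (shiftForget D).obj X) {n m : Γ}
    (h : m = n + G.one) (h' : m + -G.one = n) (x : M.X m) :
    (ofCone ψ).f n (coneInr D M n (M.castHom h x)) = X.castHom h' (ψ.f m x) := by
  subst h
  rw [M.castHom_rfl]
  refine (congr_arg₂ (· + ·) ?_ rfl).trans (zero_add _)
  exact (congr_arg (X.d _) (map_zero (ψ.f n))).trans (map_zero _)

variable (D) in
/-- The contractible cdg modules are free. -/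
def shiftForgetAdjunction : coneFunctor D ⊣ shiftForget D :=
  Adjunction.mkOfHomEquiv
    { homEquiv M X :=
        { toFun (φ : cone D M ⟶ X) :=
            { f := fun n => (φ.f (n + -G.one)).comp ((coneInr D M _).comp
                (M.castHom (neg_add_cancel_right n G.one).symm))
              map_act := fun h a x => cone_map_act_inr φ h _ _ (by rw [← h, add_assoc]) a x }
          invFun := ofCone
          left_inv (φ : cone D M ⟶ X) := by
            refine CDGMod.hom_ext fun n (x : M.X n × M.X (n + G.one)) => ?_
            change X.d _ (φ.f _ (coneInr D M _ (M.castHom _ x.1))) +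
              X.castHom _ (φ.f _ (coneInr D M _ (M.castHom _ x.2))) = φ.f n x
            rw [cone_map_d, cone_map_castHom, ← map_add, coneInl_add_coneInr]
          right_inv ψ := GrMod.hom_ext fun n x =>
            (ofCone_inr ψ (neg_add_cancel_right n G.one).symm rfl x).trans (X.castHom_rfl rfl _) }
      homEquiv_naturality_left_symm _ _ := rfl
      homEquiv_naturality_right _ _ := rfl }

end CDG

/-! ### Graded splittings, projectivity and injectivity -/

namespace CDG

open AbelianModel

variable {Γ : Type u} [AddCommGroup Γ] [DecidableEq Γ] {G : GradingGroup Γ} {A : Type u} [Ring A]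
  {𝒜 : Γ → AddSubgroup A} [GradedRing 𝒜] {D : CDGStructure G 𝒜}

lemma mono_of_injective {X Y : CDGMod D} (φ : X ⟶ Y) (h : ∀ n, Function.Injective (φ.f n)) :
    Mono φ :=
  ⟨fun _ _ e => CDGMod.hom_ext fun n x => h n (CDGMod.congr_f e n x)⟩

lemma epi_of_surjective {X Y : CDGMod D} (φ : X ⟶ Y) (h : ∀ n, Function.Surjective (φ.f n)) :
    Epi φ :=
  ⟨fun _ _ e => CDGMod.hom_ext fun n y => by
    obtain ⟨x, rfl⟩ := h n y
    exact CDGMod.congr_f e n x⟩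

instance : (CDGMod.forget D).Faithful where
  map_injective h := CDGMod.hom_ext fun n x => GrMod.congr_f h n x

instance : (shiftForget D).Faithful := inferInstanceAs ((_ ⋙ _ : _ ⥤ _).Faithful)

instance : (CDGMod.forget D).PreservesEpimorphisms :=
  Functor.preservesEpimorphisms_of_adjunction (forgetAdjunction D)

instance : (CDGMod.forget D).PreservesMonomorphisms where
  preserves φ _ := GrMod.mono_of_injective _ fun n => CDGMod.injective_of_mono φ n

instance : (shiftForget D).PreservesEpimorphisms :=
  inferInstanceAs ((_ ⋙ _ : _ ⥤ _).PreservesEpimorphisms)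

instance : (coneFunctor D).PreservesEpimorphisms :=
  Functor.preservesEpimorphisms_of_adjunction (shiftForgetAdjunction D)

instance : (coneFunctor D).PreservesMonomorphisms :=
  Functor.preservesMonomorphisms_of_adjunction (forgetAdjunction D)

variable (D) in
include D in
-- Epimorphisms of graded modules are tested in the category of cdg modules: `coneFunctor` preserves
-- them, and there epimorphisms are already known to be surjective.
lemma GrMod.surjective_of_epi {M N : GrMod 𝒜} (φ : M ⟶ N) [Epi φ] (n : Γ) :
    Function.Surjective (φ.f n) := fun y => by
  obtain ⟨x, hx⟩ := CDGMod.surjective_of_epi ((coneFunctor D).map φ) n (coneInl D N n y)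
  exact ⟨x.1, congr_arg Prod.fst hx⟩

lemma exact_apply {S : ShortComplex (CDGMod D)} (hS : S.ShortExact) {n : Γ} (x : S.X₂.X n)
    (hx : S.g.f n x = 0) : ∃ y, S.f.f n y = x := by
  have := hS.mono_f
  let l := hS.exact.lift (CDGMod.kerι S.g) (CDGMod.kerι_comp S.g)
  have hl : l ≫ S.f = CDGMod.kerι S.g := hS.exact.lift_f _ _
  exact ⟨l.f n ⟨x, hx⟩, CDGMod.congr_f hl n ⟨x, hx⟩⟩

lemma comp_apply_eq_zero {S : ShortComplex (CDGMod D)} {n : Γ} (x : S.X₁.X n) :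
    S.g.f n (S.f.f n x) = 0 :=
  CDGMod.congr_f S.zero n x

/-- A short exact sequence of cdg modules with a retraction of graded modules has a section of
graded modules. -/
lemma exists_section_of_retraction {S : ShortComplex (CDGMod D)} (hS : S.ShortExact)
    (r : (CDGMod.forget D).obj S.X₂ ⟶ (CDGMod.forget D).obj S.X₁)
    (hr : (CDGMod.forget D).map S.f ≫ r = 𝟙 _) :
    ∃ s : (CDGMod.forget D).obj S.X₃ ⟶ (CDGMod.forget D).obj S.X₂,
      s ≫ (CDGMod.forget D).map S.g = 𝟙 _ := by
  have := hS.epi_g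
  have surj := CDGMod.surjective_of_epi S.g
  let r' : ∀ n, S.X₂.X n →+ S.X₁.X n := r.f
  have hra : ∀ {p q t : Γ} (h : p + q = t) (a : 𝒜 p) (x : S.X₂.X q),
    r' t (S.X₂.act h a x) = S.X₁.act h a (r' q x) := r.map_act
  -- The map `e = 1 - f r` kills the image of `S.f`, so it descends along `S.g`; the descended map
  -- is the section.
  let e : ∀ n, S.X₂.X n →+ S.X₂.X n := fun n => AddMonoidHom.id _ - (S.f.f n).comp (r' n)
  have he : ∀ n (x : S.X₂.X n), e n x = x - S.f.f n (r' n x) := fun _ _ => rfl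
  have hre : ∀ n (x : S.X₁.X n), r' n (S.f.f n x) = x := fun n x => GrMod.congr_f hr n x
  have key : ∀ n (x x' : S.X₂.X n), S.g.f n x = S.g.f n x' → e n x = e n x' := fun n x x' h => by
    obtain ⟨y, hy⟩ := exact_apply hS (x - x') (by rw [map_sub, h, sub_self])
    rw [← sub_eq_zero, ← map_sub, ← hy, he, hre, sub_self]
  have hea : ∀ {p q t : Γ} (h : p + q = t) (a : 𝒜 p) (x : S.X₂.X q),
      e t (S.X₂.act h a x) = S.X₂.act h a (e q x) := fun h a x => by
    rw [he, he, map_sub, hra, S.f.map_act]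
  have hge : ∀ n (x : S.X₂.X n), S.g.f n (e n x) = S.g.f n x := fun n x => by
    rw [he, map_sub, comp_apply_eq_zero, sub_zero]
  choose y hy using surj
  have hadd : ∀ n (z z' : S.X₃.X n), e n (y n (z + z')) = e n (y n z) + e n (y n z') :=
    fun n z z' => (key _ _ _ (by rw [map_add, hy, hy, hy])).trans (map_add _ _ _)
  have hact : ∀ {p q t : Γ} (h : p + q = t) (a : 𝒜 p) (z : S.X₃.X q),
      e t (y t (S.X₃.act h a z)) = S.X₂.act h a (e q (y q z)) := fun h a z =>
    (key _ _ _ (by rw [S.g.map_act, hy, hy])).trans (hea h a _)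
  exact ⟨{ f := fun n => AddMonoidHom.mk' (fun z => e n (y n z)) (hadd n)
           map_act := hact }, GrMod.hom_ext fun n z => (hge n _).trans (hy n z)⟩

/-- A short exact sequence of cdg modules with a section of graded modules has a retraction of
graded modules. -/
lemma exists_retraction_of_section {S : ShortComplex (CDGMod D)} (hS : S.ShortExact)
    (s : (CDGMod.forget D).obj S.X₃ ⟶ (CDGMod.forget D).obj S.X₂)
    (hs : s ≫ (CDGMod.forget D).map S.g = 𝟙 _) :
    ∃ r : (CDGMod.forget D).obj S.X₂ ⟶ (CDGMod.forget D).obj S.X₁,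
      (CDGMod.forget D).map S.f ≫ r = 𝟙 _ := by
  have := hS.mono_f
  have inj := CDGMod.injective_of_mono S.f
  let s' : ∀ n, S.X₃.X n →+ S.X₂.X n := s.f
  have hs' : ∀ n (z : S.X₃.X n), S.g.f n (s' n z) = z := fun n z => GrMod.congr_f hs n z
  have hsa : ∀ {p q t : Γ} (h : p + q = t) (a : 𝒜 p) (x : S.X₃.X q),
    s' t (S.X₃.act h a x) = S.X₂.act h a (s' q x) := s.map_act
  -- The element `x - s (g x)` lies in the kernel of `S.g`; its preimage under `S.f` is the
  -- retraction of `x`.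
  have h : ∀ n (x : S.X₂.X n), ∃ y, S.f.f n y = x - s' n (S.g.f n x) := fun n x =>
    exact_apply hS _ (by rw [map_sub, hs', sub_self])
  choose y hy using h
  have hadd : ∀ n (x x' : S.X₂.X n), y n (x + x') = y n x + y n x' := fun n x x' => inj n (by
    rw [map_add, hy, hy, hy, map_add, map_add]
    abel)
  have hact : ∀ {p q t : Γ} (h : p + q = t) (a : 𝒜 p) (x : S.X₂.X q),
      y t (S.X₂.act h a x) = S.X₁.act h a (y q x) := fun h a x => inj _ (by
    rw [S.f.map_act, hy, hy, map_sub, ← hsa, ← S.g.map_act])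
  have hid : ∀ n (x : S.X₁.X n), y n (S.f.f n x) = x := fun n x => inj n (by
    rw [hy, comp_apply_eq_zero, map_zero, sub_zero])
  exact ⟨{ f := fun n => AddMonoidHom.mk' (y n) (hadd n)
           map_act := hact }, GrMod.hom_ext hid⟩

lemma shortExact_cokernel {X Y : CDGMod D} (f : X ⟶ Y) [Mono f] :
    (ShortComplex.mk f (cokernel.π f) (cokernel.condition f)).ShortExact where
  exact := ShortComplex.exact_cokernel f

lemma shortExact_kernel {X Y : CDGMod D} (f : X ⟶ Y) [Epi f] :
    (ShortComplex.mk (kernel.ι f) f (kernel.condition f)).ShortExact where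
  exact := ShortComplex.exact_kernel f

/-- The class of graded projective cdg modules. -/
def gradedProjective (D : CDGStructure G 𝒜) : ObjectProperty (CDGMod D) :=
  CDGMod.IsGradedProjective

/-- The class of graded injective cdg modules. -/
def gradedInjective (D : CDGStructure G 𝒜) : ObjectProperty (CDGMod D) :=
  CDGMod.IsGradedInjective

instance : (gradedProjective D).IsStableUnderRetracts where
  of_retract {X Y} r h := by
    have : Projective ((CDGMod.forget D).obj Y) := h
    exact (r.map (CDGMod.forget D)).projective

instance : (gradedInjective D).IsStableUnderRetracts where
  of_retract {X Y} r h := by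
    have : Injective ((CDGMod.forget D).obj Y) := h
    exact (r.map (CDGMod.forget D)).injective

/-- Left adjoints of epi-preserving functors preserve projectives, and right adjoints of
mono-preserving functors preserve injectives. Applied to both adjunctions, and using that shifting
is an equivalence, this gives all the transfers below. -/
lemma projective_cone {M : GrMod 𝒜} (h : Projective M) : Projective ((coneFunctor D).obj M) :=
  (shiftForgetAdjunction D).map_projective M h

lemma injective_cone {M : GrMod 𝒜} (h : Injective M) : Injective ((coneFunctor D).obj M) :=
  (forgetAdjunction D).map_injective M h

lemma gradedProjective_of_projective (X : CDGMod D) (h : Projective X) : gradedProjective D X :=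
  (forgetAdjunction D).map_projective X h

lemma gradedInjective_of_injective (X : CDGMod D) (h : Injective X) : gradedInjective D X := by
  have h' : Injective ((shiftForget D).obj X) := (shiftForgetAdjunction D).map_injective X h
  exact (GrMod.shift G (-G.one)).injective_of_map_injective h'

lemma projective_shiftForget {X : CDGMod D} (h : gradedProjective D X) :
    Projective ((shiftForget D).obj X) :=
  (GrMod.shiftEquivalence G (-G.one)).map_projective_iff _ |>.2 h

lemma injective_shiftForget {X : CDGMod D} (h : gradedInjective D X) :
    Injective ((shiftForget D).obj X) :=
  (GrMod.shiftEquivalence G (-G.one)).symm.toAdjunction.map_injective _ h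

/-- The canonical monomorphism to a contractible module. -/
def coneUnit (X : CDGMod D) : X ⟶ (coneFunctor D).obj ((CDGMod.forget D).obj X) :=
  (forgetAdjunction D).unit.app X

/-- The canonical epimorphism from a contractible module. -/
def coneCounit (X : CDGMod D) : (coneFunctor D).obj ((shiftForget D).obj X) ⟶ X :=
  (shiftForgetAdjunction D).counit.app X

instance (X : CDGMod D) : Mono (coneUnit X) := by
  unfold coneUnit; infer_instance

instance (X : CDGMod D) : Epi (coneCounit X) := by
  unfold coneCounit; infer_instance

/-- A triangle identity says that the counit retracts the unit as a map of graded modules, so the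
cokernel is a graded summand of the contractible module. -/
lemma nonempty_retract_cokernel_coneUnit (X : CDGMod D) :
    Nonempty (Retract ((CDGMod.forget D).obj (cokernel (coneUnit X)))
      ((CDGMod.forget D).obj ((coneFunctor D).obj ((CDGMod.forget D).obj X)))) := by
  obtain ⟨s, hs⟩ := exists_section_of_retraction (shortExact_cokernel (coneUnit X))
    ((forgetAdjunction D).counit.app _) ((forgetAdjunction D).left_triangle_components X)
  exact ⟨⟨s, _, hs⟩⟩

/-- The other triangle identity splits the counit, but only after a shift, which is removed because
the shift is fully faithful. -/
lemma nonempty_retract_kernel_coneCounit (X : CDGMod D) :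
    Nonempty (Retract ((CDGMod.forget D).obj (kernel (coneCounit X)))
      ((CDGMod.forget D).obj ((coneFunctor D).obj ((shiftForget D).obj X)))) := by
  let s₀ : (GrMod.shift G (-G.one)).obj ((CDGMod.forget D).obj X) ⟶
      (GrMod.shift G (-G.one)).obj
        ((CDGMod.forget D).obj ((coneFunctor D).obj ((shiftForget D).obj X))) :=
    (shiftForgetAdjunction D).unit.app ((shiftForget D).obj X)
  have h : s₀ ≫ (GrMod.shift G (-G.one)).map ((CDGMod.forget D).map (coneCounit X)) = 𝟙 _ :=
    (shiftForgetAdjunction D).right_triangle_components X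
  obtain ⟨s, hs⟩ := (GrMod.shift G (-G.one)).map_surjective s₀
  obtain ⟨r, hr⟩ := exists_retraction_of_section (shortExact_kernel (coneCounit X)) s
    ((GrMod.shift G (-G.one)).map_injective ((Functor.map_comp _ _ _).trans
      ((congr_arg (· ≫ _) hs).trans (h.trans (CategoryTheory.Functor.map_id _ _).symm))))
  exact ⟨⟨_, r, hr⟩⟩

end CDG

/-! ### The axioms for the cofibrant and fibrant classes -/

namespace CDG

open AbelianModel

variable {Γ : Type u} [AddCommGroup Γ] [DecidableEq Γ] {G : GradingGroup Γ} {A : Type u} [Ring A]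
  {𝒜 : Γ → AddSubgroup A} [GradedRing 𝒜] {D : CDGStructure G 𝒜}

lemma exists_graded_retraction {X Y : CDGMod D} {i : X ⟶ Y} (hi : cof (gradedProjective D) i) :
    ∃ r : (CDGMod.forget D).obj Y ⟶ (CDGMod.forget D).obj X,
      (CDGMod.forget D).map i ≫ r = 𝟙 _ := by
  have := hi.1
  have : Projective ((CDGMod.forget D).obj (cokernel i)) := hi.2
  exact exists_retraction_of_section (shortExact_cokernel i)
    (Projective.factorThru (𝟙 _) ((CDGMod.forget D).map (cokernel.π i)))
    (Projective.factorThru_comp _ _)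

lemma exists_graded_section {X Y : CDGMod D} {f : X ⟶ Y} (hf : fib (gradedInjective D) f) :
    ∃ s : (CDGMod.forget D).obj Y ⟶ (CDGMod.forget D).obj X,
      s ≫ (CDGMod.forget D).map f = 𝟙 _ := by
  have := hf.1
  have : Injective ((CDGMod.forget D).obj (kernel f)) := hf.2
  exact exists_section_of_retraction (shortExact_kernel f)
    (Injective.factorThru (𝟙 _) ((CDGMod.forget D).map (kernel.ι f)))
    (Injective.comp_factorThru _ _)

/-- Morphisms to a contractible module extend along graded split monomorphisms. -/
lemma exists_extension_cone {X Y : CDGMod D} {i : X ⟶ Y} (hi : cof (gradedProjective D) i)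
    {M : GrMod 𝒜} (a : X ⟶ (coneFunctor D).obj M) : ∃ b, i ≫ b = a := by
  obtain ⟨r, hr⟩ := exists_graded_retraction hi
  obtain ⟨a', rfl⟩ := ((forgetAdjunction D).homEquiv X M).surjective a
  refine ⟨(forgetAdjunction D).homEquiv Y M (r ≫ a'), ?_⟩
  rw [← Adjunction.homEquiv_naturality_left, reassoc_of% hr]

/-- Morphisms from a contractible module lift along graded split epimorphisms. -/
lemma exists_lift_cone {X Y : CDGMod D} {f : X ⟶ Y} (hf : fib (gradedInjective D) f)
    {M : GrMod 𝒜} (b : (coneFunctor D).obj M ⟶ Y) : ∃ a, a ≫ f = b := by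
  obtain ⟨s, hs⟩ := exists_graded_section hf
  have hs' : (GrMod.shift G (-G.one)).map s ≫ (shiftForget D).map f = 𝟙 _ :=
    (Functor.map_comp _ _ _).symm.trans ((congr_arg _ hs).trans (CategoryTheory.Functor.map_id _ _))
  obtain ⟨b', rfl⟩ := ((shiftForgetAdjunction D).homEquiv M Y).symm.surjective b
  refine ⟨((shiftForgetAdjunction D).homEquiv M X).symm
    (b' ≫ (GrMod.shift G (-G.one)).map s), ?_⟩
  rw [← Adjunction.homEquiv_naturality_right_symm]
  exact congr_arg _ ((Category.assoc _ _ _).trans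
    ((congr_arg (b' ≫ ·) hs').trans (Category.comp_id _)))

/-- A projective module is a retract of its contractible cover, which reduces the claim to
`exists_extension_cone`. -/
lemma exists_extension_of_projective {X Y E : CDGMod D} (i : X ⟶ Y)
    (hi : cof (gradedProjective D) i) (_ : Projective E) (a : X ⟶ E) : ∃ b, i ≫ b = a := by
  obtain ⟨b, hb⟩ := exists_extension_cone hi (a ≫ Projective.factorThru (𝟙 E) (coneCounit E))
  exact ⟨b ≫ coneCounit E, by
    rw [reassoc_of% hb, Projective.factorThru_comp, Category.comp_id]⟩

lemma exists_lift_of_injective {X Y E : CDGMod D} (f : X ⟶ Y)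
    (hf : fib (gradedInjective D) f) (_ : Injective E) (b : E ⟶ Y) : ∃ a, a ≫ f = b := by
  obtain ⟨a, ha⟩ := exists_lift_cone hf (Injective.factorThru (𝟙 E) (coneUnit E) ≫ b)
  exact ⟨coneUnit E ≫ a, by
    rw [Category.assoc, ha, Injective.comp_factorThru_assoc, Category.id_comp]⟩

lemma gradedProjective_cone {M : GrMod 𝒜} (h : Projective M) :
    gradedProjective D ((coneFunctor D).obj M) :=
  gradedProjective_of_projective _ (projective_cone h)

lemma gradedInjective_cone {M : GrMod 𝒜} (h : Injective M) :
    gradedInjective D ((coneFunctor D).obj M) :=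
  gradedInjective_of_injective _ (injective_cone h)

/-- The class of graded projective modules satisfies the conditions for the existence of the
contraderived model structure, up to the existence of factorizations. -/
lemma isCofibrantClass_gradedProjective [EnoughProjectives (CDGMod D)]
    [(cof (gradedProjective D)).HasFactorization (cof (gradedProjective D)).rlp] :
    IsCofibrantClass (gradedProjective D) where
  retract := inferInstance
  of_projective := gradedProjective_of_projective
  extension := exists_extension_of_projective
  embedding X hX := ⟨_, coneUnit X, projective_cone hX, inferInstance, by
    have : Projective _ := gradedProjective_cone (D := D) hX
    exact (nonempty_retract_cokernel_coneUnit X).some.projective⟩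
  presentation X hX := ⟨_, coneCounit X, projective_cone (projective_shiftForget hX),
    inferInstance, by
      have : Projective _ := gradedProjective_cone (D := D) (projective_shiftForget hX)
      exact (nonempty_retract_kernel_coneCounit X).some.projective⟩
  enoughProjectives := inferInstance
  factorization := inferInstance

/-- The class of graded injective modules satisfies the conditions for the existence of the
coderived model structure, up to the existence of factorizations. -/
lemma isFibrantClass_gradedInjective [EnoughInjectives (CDGMod D)]
    [(fib (gradedInjective D)).llp.HasFactorization (fib (gradedInjective D))] :
    IsFibrantClass (gradedInjective D) where
  retract := inferInstance
  of_injective := gradedInjective_of_injective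
  lifting := exists_lift_of_injective
  presentation X hX := ⟨_, coneCounit X, injective_cone (injective_shiftForget hX),
    inferInstance, by
      have : Injective _ := gradedInjective_cone (D := D) (injective_shiftForget hX)
      exact (nonempty_retract_kernel_coneCounit X).some.injective⟩
  embedding X hX := ⟨_, coneUnit X, injective_cone hX, inferInstance, by
    have : Injective _ := gradedInjective_cone (D := D) hX
    exact (nonempty_retract_cokernel_coneUnit X).some.injective⟩
  enoughInjectives := inferInstance
  factorization := inferInstance

end CDG

namespace CDG

variable {Γ : Type u} [AddCommGroup Γ] [DecidableEq Γ] {G : GradingGroup Γ} {A : Type u} [Ring A]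
  {𝒜 : Γ → AddSubgroup A} [GradedRing 𝒜]

/-! ### Direct sums -/

namespace GrMod

variable {ι : Type u} (M : ι → GrMod 𝒜)

/-- The direct sum of a family of graded modules. -/
def dsum : GrMod 𝒜 where
  X n := Π₀ i, (M i).X n
  act h := AddMonoidHom.mk' (fun a => DFinsupp.mapRange.addMonoidHom fun i => (M i).act h a)
    (fun a b => by ext; simp)
  one_act x := DFinsupp.ext fun i => (M i).one_act (x i)
  mul_act h h' a b x := DFinsupp.ext fun i => (M i).mul_act h h' a b (x i)

variable {M}

open scoped Classical in
/-- The morphism from a direct sum given by a family of morphisms. -/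
noncomputable def dsumDesc {N : GrMod 𝒜} (φ : ∀ i, M i ⟶ N) : dsum M ⟶ N where
  f n := DFinsupp.sumAddHom fun i => (φ i).f n
  map_act {p q r} h a (x : Π₀ i, (M i).X q) := by
    have e : (DFinsupp.sumAddHom fun i => (φ i).f r).comp
        (DFinsupp.mapRange.addMonoidHom fun i => (M i).act h a) =
        (N.act h a).comp (DFinsupp.sumAddHom fun i => (φ i).f q) :=
      DFinsupp.addHom_ext fun i y => by
        simp [(φ i).map_act]
    exact DFunLike.congr_fun e x

open scoped Classical in
lemma dsumDesc_single {N : GrMod 𝒜} (φ : ∀ i, M i ⟶ N) {n : Γ} (i : ι) (x : (M i).X n) :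
    (dsumDesc φ).f n (DFinsupp.single i x) = (φ i).f n x :=
  DFinsupp.sumAddHom_single _ _ _

end GrMod

namespace CDGMod

variable {D : CDGStructure G 𝒜} {ι : Type u} (M : ι → CDGMod D)

/-- The direct sum of a family of cdg modules. -/
def dsum : CDGMod D where
  toGrMod := GrMod.dsum fun i => (M i).toGrMod
  d h := DFinsupp.mapRange.addMonoidHom fun i => (M i).d h
  leibniz {_ q _ _} h h' a (x : Π₀ i, (M i).X q) :=
    DFinsupp.ext fun i => (M i).leibniz h h' a (x i)
  d_d {n _ _} h h' (x : Π₀ i, (M i).X n) := DFinsupp.ext fun i => (M i).d_d h h' (x i)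

open scoped Classical in
/-- The inclusion of a summand. -/
noncomputable def dsumι (i : ι) : M i ⟶ dsum M :=
  ({ f n := DFinsupp.singleAddHom (fun i => (M i).X n) i
     map_act h a _ := (DFinsupp.mapRange_single (f := fun i => (M i).act h a)
      (hf := fun _ => map_zero _)).symm
     comm h _ := (DFinsupp.mapRange_single (f := fun i => (M i).d h)
      (hf := fun _ => map_zero _)).symm } : Hom _ _)

variable {M}

open scoped Classical in
/-- The morphism from a direct sum given by a family of morphisms. -/
noncomputable def dsumDesc {N : CDGMod D} (φ : ∀ i, M i ⟶ N) : dsum M ⟶ N :=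
  ({ GrMod.dsumDesc fun i => (forget D).map (φ i) with
     comm {n m} h (x : Π₀ i, (M i).X n) := by
      have e : (DFinsupp.sumAddHom fun i => (φ i).f m).comp
          (DFinsupp.mapRange.addMonoidHom fun i => (M i).d h) =
          (N.d h).comp (DFinsupp.sumAddHom fun i => (φ i).f n) :=
        DFinsupp.addHom_ext fun i y => by
          simp [(φ i).comm]
      exact DFunLike.congr_fun e x } : Hom _ _)

lemma dsumι_desc {N : CDGMod D} (φ : ∀ i, M i ⟶ N) (i : ι) : dsumι M i ≫ dsumDesc φ = φ i := by
  classical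
  exact hom_ext fun n x => GrMod.dsumDesc_single (fun i => (forget D).map (φ i)) i x

lemma dsum_hom_ext {N : CDGMod D} {φ ψ : dsum M ⟶ N} (h : ∀ i, dsumι M i ≫ φ = dsumι M i ≫ ψ) :
    φ = ψ := by
  classical
  refine hom_ext fun n x => ?_
  have e : (φ.f n : (Π₀ i, (M i).X n) →+ N.X n) = ψ.f n :=
    DFinsupp.addHom_ext fun i y => congr_f (h i) n y
  exact DFunLike.congr_fun e x

variable (M) in
/-- The direct sum as a cofan. -/
noncomputable abbrev dsumCofan : Cofan M := Cofan.mk (dsum M) (dsumι M)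

variable (M) in
/-- The direct sum is a coproduct. -/
noncomputable def isColimitDsumCofan : IsColimit (dsumCofan M) :=
  Cofan.IsColimit.mk _ (fun s => dsumDesc s.inj) (fun s i => dsumι_desc s.inj i)
    (fun s _ hm => dsum_hom_ext fun i => (hm i).trans (dsumι_desc s.inj i).symm)

instance : HasCoproducts.{u} (CDGMod D) := fun _ =>
  { has_colimit F := by
      have : HasColimit (Discrete.functor (F.obj ∘ Discrete.mk)) :=
        ⟨⟨_, isColimitDsumCofan (F.obj ∘ Discrete.mk)⟩⟩
      exact hasColimit_of_iso Discrete.natIsoFunctor }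

instance : HasColimitsOfSize.{u, u} (CDGMod D) :=
  has_colimits_of_hasCoequalizers_and_coproducts

/-! ### Evaluation -/

variable (D) in
/-- The functor sending a cdg module to the family of its homogeneous components. -/
def components : CDGMod D ⥤ (Discrete Γ ⥤ AddCommGrpCat.{u}) where
  obj X := Discrete.functor fun n => AddCommGrpCat.of (X.X n)
  map φ := Discrete.natTrans fun n => AddCommGrpCat.ofHom (φ.f n.as)

variable (D) in
/-- The functor sending a cdg module to one of its homogeneous components. -/
def component (n : Γ) : CDGMod D ⥤ AddCommGrpCat.{u} where
  obj X := AddCommGrpCat.of (X.X n)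
  map φ := AddCommGrpCat.ofHom (φ.f n)

instance (n : Γ) : (component D n).Additive where

lemma shortExact_map_component {S : ShortComplex (CDGMod D)} (hS : S.ShortExact) (n : Γ) :
    (S.map (component D n)).ShortExact := by
  have := hS.mono_f
  have := hS.epi_g
  have : Mono (S.map (component D n)).f :=
    (AddCommGrpCat.mono_iff_injective _).2 (injective_of_mono S.f n)
  have : Epi (S.map (component D n)).g :=
    (AddCommGrpCat.epi_iff_surjective _).2 (surjective_of_epi S.g n)
  exact { exact := (ShortComplex.ab_exact_iff _).2 fun x hx => exact_apply hS x hx }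

lemma preservesFiniteLimits_and_colimits_component (n : Γ) :
    PreservesFiniteLimits (component D n) ∧ PreservesFiniteColimits (component D n) := by
  have h := (component D n).exact_tfae.out 0 3
  exact h.1 fun _ hS => shortExact_map_component hS n

instance (n : Γ) : PreservesFiniteLimits (component D n) :=
  (preservesFiniteLimits_and_colimits_component n).1

instance (n : Γ) : PreservesFiniteColimits (component D n) :=
  (preservesFiniteLimits_and_colimits_component n).2

instance (n : Γ) (ι : Type u) : PreservesColimitsOfShape (Discrete ι) (component D n) := by
  classical
  have h (M : ι → CDGMod D) : PreservesColimit (Discrete.functor M) (component D n) :=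
    preservesColimit_of_preserves_colimit_cocone (isColimitDsumCofan M)
      ((isColimitMapCoconeCofanMkEquiv _ _ _).symm
        (Cofan.IsColimit.mk _
          (fun s => AddCommGrpCat.ofHom (X := AddCommGrpCat.of (Π₀ i, (M i).X n))
            (DFinsupp.sumAddHom (γ := s.pt) fun i => ((s.inj i).hom : (M i).X n →+ s.pt)))
          (fun s i => by
            ext x
            exact DFinsupp.sumAddHom_single (β := fun i => (M i).X n) (γ := s.pt)
              (fun i => (s.inj i).hom) i x)
          (fun s m hm => by
            refine AddCommGrpCat.hom_ext (DFinsupp.addHom_ext (β := fun i => (M i).X n)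
              fun i x => ?_)
            refine Eq.trans ?_ (DFinsupp.sumAddHom_single (β := fun i => (M i).X n) (γ := s.pt)
              (fun i => (s.inj i).hom) i x).symm
            exact ConcreteCategory.congr_hom (hm i) x)))
  exact ⟨fun {K} => preservesColimit_of_iso_diagram _ (Discrete.natIsoFunctor (F := K)).symm⟩

instance (n : Γ) : PreservesColimitsOfSize.{u, u} (component D n) :=
  preservesColimits_of_preservesCoequalizers_and_coproducts _

instance (J : Type u) [SmallCategory J] : PreservesColimitsOfShape J (components D) :=
  preservesColimitsOfShape_of_evaluation _ _ fun n =>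
    inferInstanceAs (PreservesColimitsOfShape J (component D n.as))

instance : PreservesFiniteLimits (components D) where
  preservesFiniteLimits J _ _ := preservesLimitsOfShape_of_evaluation _ _ fun n =>
    inferInstanceAs (PreservesLimitsOfShape J (component D n.as))

instance : (components D).Faithful where
  map_injective h := hom_ext fun n x =>
    ConcreteCategory.congr_hom (NatTrans.congr_app h ⟨n⟩) x

instance : ReflectsFiniteLimits (components D) where
  reflects _ _ _ := reflectsLimitsOfShape_of_reflectsIsomorphisms

/-- Exactness of filtered colimits is inherited from families of abelian groups, because
`components` preserves colimits and finite limits and reflects finite limits. -/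
instance : AB5OfSize.{u, u} (CDGMod D) where
  ofShape J _ _ := HasExactColimitsOfShape.domain_of_functor J (components D)

end CDGMod

/-! ### Free modules -/

/-- The unit element in a component of degree zero. -/
def gone {n : Γ} (h : n = 0) : 𝒜 n := ⟨1, h ▸ SetLike.GradedOne.one_mem⟩

namespace GrMod

variable (𝒜) in
/-- The free graded module on a generator of degree `g`. -/
def regular (g : Γ) : GrMod 𝒜 where
  X n := 𝒜 (n - g)
  act {p q r} h := AddMonoidHom.mk' (fun a => AddMonoidHom.mk'
    (fun x => gmul (by rw [← h, add_sub_assoc]) a x)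
    (fun x y => Subtype.ext (mul_add _ _ _))) (fun a b => by
      ext
      exact add_mul _ _ _)
  one_act x := Subtype.ext (one_mul _)
  mul_act _ _ _ _ _ := Subtype.ext (mul_assoc _ _ _)

/-- The morphism from a free graded module on a generator of degree `g` given by an element. -/
def regularHom {g : Γ} {M : GrMod 𝒜} (x : M.X g) : regular 𝒜 g ⟶ M where
  f n := (M.act (sub_add_cancel n g)).flip x
  map_act {p q r} h a b := M.act_gmul (sub_add_cancel q g) h (sub_add_cancel r g)
    (by rw [← h, add_sub_assoc]) a b x

lemma regularHom_one {g : Γ} {M : GrMod 𝒜} (x : M.X g) :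
    (regularHom x).f g (gone (sub_self g)) = x :=
  (M.act_congr (sub_add_cancel g g) (zero_add g) (gone (sub_self g))
    ⟨1, SetLike.GradedOne.one_mem⟩ rfl x).trans (M.one_act x)

lemma regular_hom_ext {g : Γ} {M : GrMod 𝒜} {φ ψ : regular 𝒜 g ⟶ M}
    (h : φ.f g (gone (sub_self g)) = ψ.f g (gone (sub_self g))) : φ = ψ := by
  have e (θ : regular 𝒜 g ⟶ M) : regularHom (θ.f g (gone (sub_self g))) = θ :=
    hom_ext fun n (a : 𝒜 (n - g)) => by
      have h₁ : (regular 𝒜 g).act (sub_add_cancel n g) a (gone (𝒜 := 𝒜) (sub_self g)) = a :=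
        Subtype.ext (mul_one _)
      exact (θ.map_act (sub_add_cancel n g) a (gone (𝒜 := 𝒜) (sub_self g))).symm.trans
        (congr_arg _ h₁)
  rw [← e φ, h, e]

variable {B : Type u} (deg : B → Γ)

variable (𝒜) in
/-- The free graded module on generators of given degrees. -/
def free : GrMod 𝒜 := dsum fun b => regular 𝒜 (deg b)

open scoped Classical in
/-- The generators of the free graded module. -/
noncomputable def freeGen (b : B) : (free 𝒜 deg).X (deg b) :=
  DFinsupp.single (β := fun b' => 𝒜 (deg b - deg b')) b (gone (sub_self _))

variable {deg}

/-- The morphism from a free graded module given by a family of elements. -/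
noncomputable def freeHom {M : GrMod 𝒜} (x : ∀ b, M.X (deg b)) : free 𝒜 deg ⟶ M :=
  dsumDesc fun b => regularHom (x b)

@[simp]
lemma freeHom_gen {M : GrMod 𝒜} (x : ∀ b, M.X (deg b)) (b : B) :
    (freeHom x).f (deg b) (freeGen deg b) = x b :=
  (dsumDesc_single _ b _).trans (regularHom_one _)

lemma free_hom_ext {M : GrMod 𝒜} {φ ψ : free 𝒜 deg ⟶ M}
    (h : ∀ b, φ.f (deg b) (freeGen deg b) = ψ.f (deg b) (freeGen deg b)) : φ = ψ := by
  classical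
  let inc (b : B) : regular 𝒜 (deg b) ⟶ free 𝒜 deg :=
    { f n := DFinsupp.singleAddHom (fun b' => 𝒜 (n - deg b')) b
      map_act h a _ := (DFinsupp.mapRange_single (f := fun b' => (regular 𝒜 (deg b')).act h a)
        (hf := fun _ => map_zero _)).symm }
  have h' (b : B) : inc b ≫ φ = inc b ≫ ψ := regular_hom_ext (h b)
  refine hom_ext fun n x => ?_
  have e : (φ.f n : (Π₀ b, 𝒜 (n - deg b)) →+ M.X n) = ψ.f n :=
    DFinsupp.addHom_ext fun b y => congr_f (h' b) n y
  exact DFunLike.congr_fun e x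

end GrMod

end CDG

/-! ### Free cdg modules and the Grothendieck property -/

namespace CDG

open AbelianModel

variable {Γ : Type u} [AddCommGroup Γ] [DecidableEq Γ] {G : GradingGroup Γ} {A : Type u} [Ring A]
  {𝒜 : Γ → AddSubgroup A} [GradedRing 𝒜]

lemma GrMod.castHom_injective (M : GrMod 𝒜) {n m : Γ} (h : n = m) :
    Function.Injective (M.castHom h) := by
  subst h
  intro x y hxy
  simpa using hxy

lemma GrMod.projective_free {B : Type u} (D : CDGStructure G 𝒜) (deg : B → Γ) :
    Projective (free 𝒜 deg) where
  factors {M N} φ e _ := by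
    choose y hy using fun b => surjective_of_epi D e (deg b) (φ.f (deg b) (freeGen deg b))
    refine ⟨freeHom y, free_hom_ext fun b => ?_⟩
    rw [comp_f, freeHom_gen, hy]

lemma GrMod.exists_epi_free (M : GrMod 𝒜) :
    ∃ (B : Type u) (deg : B → Γ) (π : free 𝒜 deg ⟶ M), Epi π :=
  ⟨Σ n, M.X n, fun b => b.1, freeHom fun b => b.2, epi_of_surjective _ fun n x =>
    ⟨freeGen (fun b : Σ n, M.X n => b.1) ⟨n, x⟩,
      freeHom_gen (deg := fun b : Σ n, M.X n => b.1) (fun b => b.2) ⟨n, x⟩⟩⟩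

namespace CDGMod

variable {D : CDGStructure G 𝒜} {B : Type u} (deg : B → Γ)

variable (D) in
/-- The free cdg module on generators of given degrees. -/
noncomputable def free : CDGMod D :=
  -- The degrees are raised by one because the generators sit in the second summand, which lowers
  -- degrees by one.
  (coneFunctor D).obj (GrMod.free 𝒜 fun b => deg b + G.one)

variable (D) in
/-- The generators of a free cdg module. -/
noncomputable def gen (b : B) : (free D deg).X (deg b) :=
  coneInr D _ _ (GrMod.freeGen (fun b => deg b + G.one) b)

variable {deg}

/-- The morphism from a free cdg module given by a family of elements. -/
noncomputable def freeHom {X : CDGMod D} (x : ∀ b, X.X (deg b)) : free D deg ⟶ X :=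
  ofCone (GrMod.freeHom fun b => X.castHom (add_neg_cancel_right _ _).symm (x b))

@[simp]
lemma freeHom_gen {X : CDGMod D} (x : ∀ b, X.X (deg b)) (b : B) :
    (freeHom x).f (deg b) (gen D deg b) = x b := by
  let y : ∀ b, ((shiftForget D).obj X).X (deg b + G.one) :=
    fun b => X.castHom (add_neg_cancel_right _ _).symm (x b)
  have h := ofCone_inr (GrMod.freeHom y) rfl (add_neg_cancel_right (deg b) G.one)
    (GrMod.freeGen (fun b => deg b + G.one) b)
  rw [GrMod.castHom_rfl, GrMod.freeHom_gen] at h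
  exact h.trans ((X.castHom_castHom _ _ _).trans (X.castHom_rfl rfl _))

lemma free_hom_ext {X : CDGMod D} {φ ψ : free D deg ⟶ X}
    (h : ∀ b, φ.f (deg b) (gen D deg b) = ψ.f (deg b) (gen D deg b)) : φ = ψ := by
  obtain ⟨φ', rfl⟩ := ((shiftForgetAdjunction D).homEquiv _ X).symm.surjective φ
  obtain ⟨ψ', rfl⟩ := ((shiftForgetAdjunction D).homEquiv _ X).symm.surjective ψ
  refine congr_arg _ (GrMod.free_hom_ext fun b => ?_)
  have e (θ : GrMod.free 𝒜 (fun b => deg b + G.one) ⟶ (shiftForget D).obj X) :=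
    ofCone_inr θ rfl (add_neg_cancel_right (deg b) G.one) (GrMod.freeGen (fun b => deg b + G.one) b)
  have h' := (e φ').symm.trans ((by
    rw [GrMod.castHom_rfl]
    exact h b : _ = (ofCone ψ').f _ _).trans (e ψ'))
  exact X.castHom_injective (add_neg_cancel_right (deg b) G.one) h'

variable (D deg) in
lemma projective_free : Projective (free D deg) :=
  projective_cone (GrMod.projective_free D _)

lemma exists_epi_free (X : CDGMod D) : ∃ (B : Type u) (deg : B → Γ) (π : free D deg ⟶ X), Epi π :=
  ⟨Σ n, X.X n, fun b => b.1, freeHom fun b => b.2, epi_of_surjective _ fun n x =>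
    ⟨gen D (fun b : Σ n, X.X n => b.1) ⟨n, x⟩,
      freeHom_gen (deg := fun b : Σ n, X.X n => b.1) (fun b => b.2) ⟨n, x⟩⟩⟩

instance : EnoughProjectives (CDGMod D) where
  presentation X := by
    obtain ⟨B, deg, π, hπ⟩ := exists_epi_free X
    exact ⟨{ p := free D deg, projective := projective_free D deg, f := π, epi := hπ }⟩

/-- With one generator in each degree, any element `x` of degree `n` is the image of the `n`-th
generator under a morphism sending the others to zero, hence `Pi.single n x`. -/
lemma isSeparator_free : IsSeparator (free D (id : Γ → Γ)) :=
  (isSeparator_def _).2 fun X Y φ ψ h => hom_ext fun n x => by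
    have := congr_f (h (freeHom (Pi.single n x))) n (gen D id n)
    have e : (freeHom (D := D) (deg := id) (Pi.single n x : ∀ n, X.X n)).f n (gen D id n) = x :=
      (freeHom_gen (deg := id) _ n).trans (Pi.single_eq_same n x)
    rwa [comp_f, comp_f, e] at this

instance : IsGrothendieckAbelian.{u} (CDGMod D) where
  hasSeparator := ⟨_, isSeparator_free⟩

end CDGMod

end CDG

/-! ### The small object argument in Grothendieck abelian categories -/

namespace CategoryTheory

universe w v' u'

open MorphismProperty

/-- Choose a regular `κ` exceeding the number of subobjects of every source. Pushouts of coproducts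
of monomorphisms are monomorphisms, so the relevant chains consist of monomorphisms, and Hom from
such a source commutes with their colimits. -/
lemma IsGrothendieckAbelian.hasSmallObjectArgument {C : Type u'} [Category.{v'} C] [Abelian C]
    [IsGrothendieckAbelian.{w} C] (I : MorphismProperty C) [IsSmall.{w} I]
    (hI : I ≤ monomorphisms C) : HasSmallObjectArgument.{w} I := by
  obtain ⟨κ, hκ', hκ⟩ := HasCardinalLT.exists_regular_cardinal_forall.{w}
    (fun f : Shrink.{w} I.toSet => Subobject ((equivShrink _).symm f).1.left)
  have : Fact κ.IsRegular := ⟨hκ'⟩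
  have : Nonempty κ.ord.ToType := by simpa using hκ'.ne_zero
  have := WellFoundedLT.toOrderBot κ.ord.ToType
  exact ⟨κ, inferInstance, inferInstance,
    { preservesColimit {A B X Y} i hi f hf := by
        let hf' : (monomorphisms C).TransfiniteCompositionOfShape κ.ord.ToType f :=
          { toTransfiniteCompositionOfShape := hf.toTransfiniteCompositionOfShape
            map_mem j hj := by
              have := (hf.attachCells j hj).pushouts_coproducts
              simp only [ofHoms_homFamily] at this
              refine (?_ : _ ≤ monomorphisms C) _ this
              simpa only [pushouts_le_iff, coproducts_le_iff] using hI }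
        have (j j' : κ.ord.ToType) (φ : j ⟶ j') : Mono (hf'.F.map φ) := hf'.mem_map φ
        refine preservesColimit_coyoneda_obj_of_mono (Y := hf'.F) (κ := κ) ?_
        have := hκ (equivShrink _ ⟨Arrow.mk i, hi⟩)
        rwa [Equiv.symm_apply_apply] at this }⟩

end CategoryTheory

namespace CDG

open AbelianModel MorphismProperty

variable {Γ : Type u} [AddCommGroup Γ] [DecidableEq Γ] {G : GradingGroup Γ} {A : Type u} [Ring A]
  {𝒜 : Γ → AddSubgroup A} [GradedRing 𝒜] (D : CDGStructure G 𝒜)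

/-! ### Generators of the coderived model structure -/

/-- The functor sending a cdg module to the source of its canonical contractible cover. -/
def cover : CDGMod D ⥤ CDGMod D := shiftForget D ⋙ coneFunctor D

instance : (cover D).Additive where

/-- The generating trivial cofibrations of the coderived model structure. -/
noncomputable def coderivedGenerators : MorphismProperty (CDGMod D) :=
  ofHoms fun N : Subobject (CDGMod.free D (id : Γ → Γ)) => (cover D).map N.arrow

instance : MorphismProperty.IsSmall.{u} (coderivedGenerators D) := by
  unfold coderivedGenerators
  infer_instance

instance : (shiftForget D).PreservesMonomorphisms :=
  inferInstanceAs ((_ ⋙ _ : _ ⥤ _).PreservesMonomorphisms)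

instance : (cover D).PreservesMonomorphisms :=
  inferInstanceAs ((_ ⋙ _ : _ ⥤ _).PreservesMonomorphisms)

instance : HasSmallObjectArgument.{u} (coderivedGenerators D) :=
  IsGrothendieckAbelian.hasSmallObjectArgument _ (by
    rintro _ _ _ ⟨N⟩
    exact inferInstanceAs (Mono ((cover D).map N.arrow)))

variable {D}

/-- The canonical contractible cover of a cdg module. -/
def coverπ (X : CDGMod D) : (cover D).obj X ⟶ X := coneCounit X

instance (X : CDGMod D) : Epi (coverπ X) := inferInstanceAs (Epi (coneCounit X))

lemma epi_of_rlp_coderivedGenerators {X Y : CDGMod D} {f : X ⟶ Y}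
    (hf : (coderivedGenerators D).rlp f) : Epi f := by
  rw [Preadditive.epi_iff_cancel_zero]
  intro Z g hg
  refine (isSeparator_def _).1 CDGMod.isSeparator_free _ _ fun h => ?_
  -- For `N = ⊥` the source of the generator vanishes, so every map from the contractible cover of
  -- the separator lifts through `f`.
  let N : Subobject (CDGMod.free D (id : Γ → Γ)) := ⊥
  have hN : IsZero (N : CDGMod D) := (isZero_zero _).of_iso Subobject.botCoeIsoZero
  have := hf _ ⟨N⟩
  have sq : CommSq (0 : (cover D).obj (N : CDGMod D) ⟶ X) ((cover D).map N.arrow) f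
    (coverπ _ ≫ h) := ⟨((cover D).map_isZero hN).eq_of_src _ _⟩
  rw [← cancel_epi (coverπ _), ← Category.assoc, ← sq.fac_right, Category.assoc, hg]
  simp

/-- Through the two adjunctions the hypothesis becomes extension of maps into the contractible
module on `K` along subobjects of a separator. Baer's criterion makes that contractible module
injective, and `K` is a graded retract of it. -/
lemma gradedInjective_of_extension {K : CDGMod D}
    (hK : ∀ (N : Subobject (CDGMod.free D (id : Γ → Γ))) (k : (cover D).obj (N : CDGMod D) ⟶ K),
      ∃ k', (cover D).map N.arrow ≫ k' = k) : gradedInjective D K := by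
  have h₁ : Injective ((coneFunctor D).obj ((CDGMod.forget D).obj K)) := by
    rw [injective_iff_rlp_monomorphisms_zero,
      ← IsGrothendieckAbelian.generatingMonomorphisms_rlp CDGMod.isSeparator_free]
    intro _ _ _ hN
    obtain ⟨N⟩ := hN
    refine ⟨fun {a b} sq => ?_⟩
    let e := (forgetAdjunction D).homEquiv
    let a₁ : (CDGMod.forget D).obj (N : CDGMod D) ⟶ (CDGMod.forget D).obj K := (e _ _).symm a
    let a₂ : (shiftForget D).obj (N : CDGMod D) ⟶ (shiftForget D).obj K :=
      (GrMod.shift G (-G.one)).map a₁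
    let e' := (shiftForgetAdjunction D).homEquiv
    obtain ⟨k, hk⟩ := hK N ((e' _ _).symm a₂)
    let b₂ : (GrMod.shift G (-G.one)).obj ((CDGMod.forget D).obj (CDGMod.free D (id : Γ → Γ))) ⟶
      (GrMod.shift G (-G.one)).obj ((CDGMod.forget D).obj K) := (e' _ _) k
    have h₂ : (shiftForget D).map N.arrow ≫ b₂ = a₂ :=
      ((shiftForgetAdjunction D).homEquiv_naturality_left _ _).symm.trans
        ((congr_arg _ hk).trans ((e' _ _).apply_symm_apply a₂))
    obtain ⟨b₁, hb₁⟩ := (GrMod.shift G (-G.one)).map_surjective b₂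
    have h₃ : (CDGMod.forget D).map N.arrow ≫ b₁ = a₁ :=
      (GrMod.shift G (-G.one)).map_injective
        ((Functor.map_comp _ _ _).trans ((congr_arg _ hb₁).trans h₂))
    exact ⟨⟨{ l := e _ _ b₁
              fac_left := by
                rw [← Adjunction.homEquiv_naturality_left, h₃]
                exact (e _ _).apply_symm_apply a
              fac_right := (isZero_zero _).eq_of_tgt _ _ }⟩⟩
  have h₄ : Injective ((CDGMod.forget D).obj ((coneFunctor D).obj ((CDGMod.forget D).obj K))) :=
    gradedInjective_of_injective _ h₁
  exact (Retract.mk _ _ ((forgetAdjunction D).left_triangle_components K)).injective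

lemma rlp_coderivedGenerators : (coderivedGenerators D).rlp = fib (gradedInjective D) := by
  ext S T f
  refine ⟨fun hf => ?_, fun hf => ?_⟩
  · have := epi_of_rlp_coderivedGenerators hf
    refine ⟨this, gradedInjective_of_extension fun N k => ?_⟩
    have := hf _ ⟨N⟩
    have sq : CommSq (k ≫ kernel.ι f) ((cover D).map N.arrow) f 0 := ⟨by simp⟩
    refine ⟨kernel.lift f sq.lift sq.fac_right, ?_⟩
    rw [← cancel_mono (kernel.ι f), Category.assoc, kernel.lift_ι, sq.fac_left]
  · have := hf.1
    have hK : Injective ((shiftForget D).obj (kernel f)) := injective_shiftForget hf.2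
    intro _ _ _ hN
    obtain ⟨N⟩ := hN
    refine ⟨fun {a b} sq => ?_⟩
    -- The map `f` splits over graded modules, so maps from a contractible module lift. The lift
    -- disagrees with `a` by a map to `kernel f`, which extends by graded injectivity of that
    -- kernel.
    obtain ⟨b', hb'⟩ : ∃ b' : (cover D).obj (CDGMod.free D (id : Γ → Γ)) ⟶ S, b' ≫ f = b :=
      exists_lift_cone hf b
    let k : (cover D).obj (N : CDGMod D) ⟶ kernel f :=
      kernel.lift f (a - (cover D).map N.arrow ≫ b') (by
        rw [Preadditive.sub_comp, sq.w, Category.assoc, hb', sub_self])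
    let e' := (shiftForgetAdjunction D).homEquiv
    let k' : (cover D).obj (CDGMod.free D (id : Γ → Γ)) ⟶ kernel f :=
      (e' _ _).symm (Injective.factorThru (e' _ _ k) ((shiftForget D).map N.arrow))
    have hk' : (cover D).map N.arrow ≫ k' = k :=
      ((shiftForgetAdjunction D).homEquiv_naturality_left_symm _ _).symm.trans
        ((congr_arg _ (Injective.comp_factorThru _ _)).trans ((e' _ _).symm_apply_apply k))
    exact ⟨⟨{ l := b' + k' ≫ kernel.ι f
              fac_left := by
                rw [Preadditive.comp_add, reassoc_of% hk', kernel.lift_ι]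
                exact add_sub_cancel _ _
              fac_right := by
                rw [Preadditive.add_comp, Category.assoc, kernel.condition, comp_zero, add_zero]
                exact hb' }⟩⟩

instance : (fib (gradedInjective D)).llp.HasFactorization (fib (gradedInjective D)) := by
  rw [← rlp_coderivedGenerators]
  infer_instance

lemma isCofibrantlyGenerated_of_isCoderivedModel (M : ModelCategory (CDGMod D))
    (hM : IsCoderivedModel M) : IsCofibrantlyGenerated.{u} M := by
  obtain ⟨h₁, h₂⟩ :=
    (isInjectiveAbelianModel_iff (P := gradedInjective D) inferInstance M).1 hM
  refine ⟨IsGrothendieckAbelian.generatingMonomorphisms (CDGMod.free D (id : Γ → Γ)),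
    coderivedGenerators D, inferInstance, inferInstance, inferInstance, inferInstance, ?_, ?_⟩
  · rw [IsGrothendieckAbelian.generatingMonomorphisms_rlp CDGMod.isSeparator_free, ← h₁,
      rlp_eq_of_wfs (cofibrations (CDGMod D)) (trivialFibrations (CDGMod D))]
  · rw [rlp_coderivedGenerators, h₂]

lemma existsUnique_isCoderivedModel : ∃! M : ModelCategory (CDGMod D), IsCoderivedModel M :=
  existsUnique_injective isFibrantClass_gradedInjective

end CDG

namespace CDG

variable {Γ : Type u} [AddCommGroup Γ] [DecidableEq Γ] {G : GradingGroup Γ} {A : Type u} [Ring A]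
  {𝒜 : Γ → AddSubgroup A} [GradedRing 𝒜]

/-! ### Supports in free graded modules -/

namespace GrMod

variable {B : Type u} (deg : B → Γ)

/-- The coordinates of an element of a free graded module. -/
def coord (b : B) : free 𝒜 deg ⟶ regular 𝒜 (deg b) where
  f n := DFinsupp.evalAddMonoidHom (β := fun b' => 𝒜 (n - deg b')) b
  map_act _ _ _ := rfl

variable {deg}

open scoped Classical in
lemma act_freeGen {n : Γ} (b : B) (a : 𝒜 (n - deg b)) :
    (free 𝒜 deg).act (sub_add_cancel n (deg b)) a (freeGen deg b) =
      (DFinsupp.single b a : Π₀ b', 𝒜 (n - deg b')) := by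
  have h : (regular 𝒜 (deg b)).act (sub_add_cancel n (deg b)) a
    (gone (𝒜 := 𝒜) (sub_self (deg b))) = a := Subtype.ext (mul_one _)
  refine (DFinsupp.mapRange_single
    (f := fun b' => (regular 𝒜 (deg b')).act (sub_add_cancel n (deg b)) a)
    (hf := fun _ => map_zero _)).trans ?_
  exact congr_arg (DFinsupp.single (β := fun b' => 𝒜 (n - deg b')) b) h

lemma finite_coord {n : Γ} (y : (free 𝒜 deg).X n) : {b | (coord deg b).f n y ≠ 0}.Finite := by
  classical
  refine (DFinsupp.support (β := fun b' => 𝒜 (n - deg b')) y).finite_toSet.subset fun b hb => ?_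
  exact DFinsupp.mem_support_iff.2 hb

lemma free_mem_of_coord {n : Γ} (y : (free 𝒜 deg).X n) (T : AddSubgroup ((free 𝒜 deg).X n))
    (h : ∀ b, (coord deg b).f n y ≠ 0 → ∀ a : 𝒜 (n - deg b),
      (free 𝒜 deg).act (sub_add_cancel n (deg b)) a (freeGen deg b) ∈ T) : y ∈ T := by
  classical
  have key (y : Π₀ b, 𝒜 (n - deg b)) (T : AddSubgroup (Π₀ b, 𝒜 (n - deg b)))
      (h : ∀ b, y b ≠ 0 → ∀ a : 𝒜 (n - deg b), DFinsupp.single b a ∈ T) : y ∈ T := by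
    rw [← DFinsupp.sum_single (f := y)]
    exact T.sum_mem fun b hb => h b (DFinsupp.mem_support_iff.1 hb) _
  exact key y T fun b hb a => by
    have := h b hb a
    rwa [act_freeGen] at this

variable {X : GrMod 𝒜} (i : X ⟶ free 𝒜 deg)

/-- The elements of a retract of a free module supported in a given set of generators. -/
def supported (S : Set B) (n : Γ) : AddSubgroup (X.X n) :=
  ⨅ b ∈ Sᶜ, ((i ≫ coord deg b).f n).ker

variable {i}

lemma mem_supported {S : Set B} {n : Γ} {x : X.X n} :
    x ∈ supported i S n ↔ ∀ b, (coord deg b).f n (i.f n x) ≠ 0 → b ∈ S := by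
  simp only [supported, AddSubgroup.mem_iInf]
  exact forall_congr' fun b => not_imp_comm

lemma act_mem_supported {S : Set B} {p q r : Γ} (h : p + q = r) (a : 𝒜 p) {x : X.X q}
    (hx : x ∈ supported i S q) : X.act h a x ∈ supported i S r := by
  rw [mem_supported] at hx ⊢
  refine fun b hb => hx b fun h0 => hb ?_
  have := (i ≫ coord deg b).map_act h a x
  exact this.trans ((congr_arg _ h0).trans (map_zero _))

lemma supported_mono {S T : Set B} (h : S ⊆ T) (n : Γ) : supported i S n ≤ supported i T n :=
  fun _ hx => mem_supported.2 fun b hb => h (mem_supported.1 hx b hb)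

lemma exists_hom_of_surjective {Q C M : GrMod 𝒜} (π : Q ⟶ C)
    (hπ : ∀ n, Function.Surjective (π.f n)) (φ : Q ⟶ M)
    (h : ∀ n x, π.f n x = 0 → φ.f n x = 0) : ∃ ψ : C ⟶ M, π ≫ ψ = φ := by
  have key : ∀ n (x y : Q.X n), π.f n x = π.f n y → φ.f n x = φ.f n y := fun n x y hxy => by
    have := h n (x - y) (by rw [map_sub, hxy, sub_self])
    rwa [map_sub, sub_eq_zero] at this
  choose g hg using hπ
  exact ⟨{ f := fun n => AddMonoidHom.mk' (fun y => φ.f n (g n y)) fun a b => by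
             rw [← map_add]
             exact key _ _ _ (by simp [hg])
           map_act := fun h a y => (key _ _ _ (by rw [π.map_act, hg, hg])).trans (φ.map_act h a _) },
    hom_ext fun n x => key n _ _ (hg n _)⟩

/-- Subquotients of a retract of a free module given by sets of generators are projective. -/
lemma projective_of_supported (D : CDGStructure G 𝒜) (r : free 𝒜 deg ⟶ X) (hir : i ≫ r = 𝟙 X)
    {S T : Set B} (hS : ∀ b ∈ S, r.f (deg b) (freeGen deg b) ∈ supported i S (deg b))
    {Q C : GrMod 𝒜} (q : Q ⟶ X) (π : Q ⟶ C) (hπ : ∀ n, Function.Surjective (π.f n))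
    (hker : ∀ n z, π.f n z = 0 ↔ q.f n z ∈ supported i S n)
    (hq : ∀ n z, q.f n z ∈ supported i (S ∪ T) n)
    (hT : ∀ b ∈ T, ∃ z, q.f (deg b) z = r.f (deg b) (freeGen deg b)) : Projective C := by
  classical
  choose! z hz using hT
  -- The module `C` embeds in `supported i (S ∪ T) / supported i S`; it becomes a summand of the
  -- free module by discarding the generators in `S`. The values of `z` outside `T` are arbitrary
  -- and play no role, since the relevant elements are supported in `S ∪ T`.
  let ζ : free 𝒜 deg ⟶ Q := freeHom fun b => if b ∈ S then 0 else z b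
  let e : free 𝒜 deg ⟶ free 𝒜 deg := freeHom fun b => if b ∈ S then 0 else freeGen deg b
  have heζ : e ≫ ζ = ζ := free_hom_ext fun b => by
    rw [comp_f]
    by_cases hb : b ∈ S <;> simp [e, ζ, hb]
  obtain ⟨j, hj⟩ := exists_hom_of_surjective π hπ (q ≫ i ≫ e) fun n x hx => by
    have hx' := mem_supported.1 ((hker n x).1 hx)
    refine free_mem_of_coord (i.f n (q.f n x)) (e.f n).ker fun b hb a => ?_
    rw [AddMonoidHom.mem_ker, e.map_act]
    simp [e, hx' b hb]
  -- Modulo `supported i S`, lifting generators by `ζ` and then applying `q` is the same as `r`: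
  -- generators in `S` contribute nothing on either side.
  have key (n : Γ) (y : (free 𝒜 deg).X n)
      (hy : ∀ b, (coord deg b).f n y ≠ 0 → b ∈ S ∪ T) :
      q.f n (ζ.f n y) - r.f n y ∈ supported i S n := by
    refine free_mem_of_coord y ((supported i S n).comap ((ζ ≫ q).f n - r.f n)) fun b hb a => ?_
    change q.f n (ζ.f n _) - r.f n _ ∈ supported i S n
    rw [ζ.map_act, q.map_act, r.map_act]
    by_cases hbS : b ∈ S
    · have : ζ.f (deg b) (freeGen deg b) = 0 := by simp [ζ, hbS]
      rw [this, map_zero, map_zero, zero_sub]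
      exact neg_mem (act_mem_supported _ _ (hS b hbS))
    · have : ζ.f (deg b) (freeGen deg b) = z b := by simp [ζ, hbS]
      rw [this, hz b ((hy b hb).resolve_left hbS), sub_self]
      exact zero_mem _
  have hr (n : Γ) (x : X.X n) : r.f n (i.f n x) = x := congr_f hir n x
  have : Projective (free 𝒜 deg) := projective_free D deg
  refine (Retract.mk j (ζ ≫ π) (hom_ext fun n c => ?_)).projective
  obtain ⟨x, rfl⟩ := hπ n c
  have h₁ : j.f n (π.f n x) = e.f n (i.f n (q.f n x)) := congr_f hj n x
  have h₂ : ζ.f n (e.f n (i.f n (q.f n x))) = ζ.f n (i.f n (q.f n x)) := congr_f heζ n _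
  change π.f n (ζ.f n (j.f n (π.f n x))) = π.f n x
  rw [h₁, h₂, ← sub_eq_zero, ← map_sub, hker, map_sub]
  have := key n (i.f n (q.f n x)) (mem_supported.1 (hq n x))
  rwa [hr] at this

end GrMod

/-! ### Submodules -/

namespace CDGMod

variable {D : CDGStructure G 𝒜} {E : CDGMod D}

/-- The families of subgroups underlying a submodule. -/
structure IsSubmodule (L : ∀ n, AddSubgroup (E.X n)) : Prop where
  act_mem : ∀ {p q r : Γ} (h : p + q = r) (a : 𝒜 p) {x : E.X q}, x ∈ L q → E.act h a x ∈ L r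
  d_mem : ∀ {n m : Γ} (h : n + G.one = m) {x : E.X n}, x ∈ L n → E.d h x ∈ L m

variable {L : ∀ n, AddSubgroup (E.X n)}

/-- A submodule as a cdg module. -/
def sub (hL : IsSubmodule L) : CDGMod D where
  X n := L n
  act h := AddMonoidHom.mk' (fun a => ((E.act h a).comp (L _).subtype).codRestrict _
      (fun x => hL.act_mem h a x.2))
    (fun a b => by
      ext x
      exact DFunLike.congr_fun (map_add (E.act h) a b) x.1)
  one_act x := Subtype.ext (E.one_act _)
  mul_act h h' a b x := Subtype.ext (E.mul_act h h' a b _)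
  d h := ((E.d h).comp (L _).subtype).codRestrict _ (fun x => hL.d_mem h x.2)
  leibniz h h' a x := Subtype.ext (E.leibniz h h' a _)
  d_d h h' x := Subtype.ext (E.d_d h h' _)

/-- The inclusion of a submodule. -/
def subι (hL : IsSubmodule L) : sub hL ⟶ E :=
  ({ f := fun n => (L n).subtype
     map_act := fun _ _ _ => rfl
     comm := fun _ _ => rfl } : Hom _ _)

lemma free_map_mem (hL : IsSubmodule L) {B : Type u} {deg : B → Γ} (φ : free D deg ⟶ E)
    (h : ∀ b, φ.f (deg b) (gen D deg b) ∈ L (deg b)) (n : Γ) (x : (free D deg).X n) :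
    φ.f n x ∈ L n := by
  let ψ : free D deg ⟶ sub hL := freeHom fun b => ⟨_, h b⟩
  have e : ψ ≫ subι hL = φ := free_hom_ext fun b =>
    congr_arg Subtype.val (freeHom_gen (X := sub hL) (fun b => (⟨_, h b⟩ : L (deg b))) b)
  rw [← e]
  exact (ψ.f n x : L n).2

/-- Elements of pullbacks. -/
lemma exists_pullback_element {X Y Z : CDGMod D} (f : X ⟶ Z) (g : Y ⟶ Z) {n : Γ} (x : X.X n)
    (y : Y.X n) (h : f.f n x = g.f n y) :
    ∃ z, (pullback.fst f g).f n z = x ∧ (pullback.snd f g).f n z = y := by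
  let deg : PUnit.{u + 1} → Γ := fun _ => n
  have hx : (freeHom (D := D) (deg := deg) fun _ => x).f n (gen D deg ⟨⟩) = x :=
    freeHom_gen (deg := deg) (fun _ => x) ⟨⟩
  have hy : (freeHom (D := D) (deg := deg) fun _ => y).f n (gen D deg ⟨⟩) = y :=
    freeHom_gen (deg := deg) (fun _ => y) ⟨⟩
  have w : freeHom (D := D) (deg := deg) (fun _ => x) ≫ f = freeHom (fun _ => y) ≫ g :=
    free_hom_ext fun _ => (congr_arg (f.f n) hx).trans (h.trans (congr_arg (g.f n) hy).symm)
  refine ⟨(pullback.lift _ _ w).f n (gen D deg ⟨⟩), ?_, ?_⟩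
  · exact (congr_f (pullback.lift_fst _ _ w) n _).trans hx
  · exact (congr_f (pullback.lift_snd _ _ w) n _).trans hy

end CDGMod

end CDG

/-! ### Countable pieces of graded projective modules -/

namespace CDG

open AbelianModel GrMod

variable {Γ : Type u} [AddCommGroup Γ] [DecidableEq Γ] {G : GradingGroup Γ} {A : Type u} [Ring A]
  {𝒜 : Γ → AddSubgroup A} [GradedRing 𝒜] {D : CDGStructure G 𝒜}

/-- The elements reached in `n` steps form a countable set, and there are countably many `n`. -/
lemma countable_setOf_reflTransGen {B : Type*} (R : B → B → Prop) (hR : ∀ b, {b' | R b b'}.Finite)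
    (b : B) : {b' | Relation.ReflTransGen R b b'}.Countable := by
  let f : ℕ → Set B := fun n => n.rec {b} fun _ s => ⋃ c ∈ s, {b' | R c b'}
  have hf (n : ℕ) : (f n).Countable := by
    induction n with
    | zero => exact Set.countable_singleton b
    | succ n ih => exact ih.biUnion fun c _ => (hR c).countable
  refine (Set.countable_iUnion hf).mono fun b' hb' => ?_
  induction hb' with
  | refl => exact Set.mem_iUnion.2 ⟨0, rfl⟩
  | tail _ h ih =>
    obtain ⟨n, hn⟩ := Set.mem_iUnion.1 ih
    exact Set.mem_iUnion.2 ⟨n + 1, Set.mem_biUnion hn h⟩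

/-! ### Filtrations of graded projective modules -/

section Filtration

variable {X : CDGMod D} {B : Type u} {deg : B → Γ} (i : X.toGrMod ⟶ GrMod.free 𝒜 deg)
  (r : GrMod.free 𝒜 deg ⟶ X.toGrMod)

/-- The element of a retract of a free module given by a generator. -/
noncomputable def elem (b : B) : X.X (deg b) := r.f (deg b) (freeGen deg b)

/-- The generators in the support of the element given by a generator, or of its differential. -/
def Child (b b' : B) : Prop :=
  (coord deg b').f _ (i.f _ (elem r b)) ≠ 0 ∨ (coord deg b').f _ (i.f _ (X.d rfl (elem r b))) ≠ 0

/-- The sets of generators stable under passing to the support and the support of the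
differential. -/
def IsClosedSet (S : Set B) : Prop := ∀ b ∈ S, ∀ b', Child i r b b' → b' ∈ S

lemma finite_child (b : B) : {b' | Child i r b b'}.Finite :=
  (finite_coord _).union (finite_coord _)

variable {i r} {S : Set B}

lemma elem_mem_supported (hS : IsClosedSet i r S) {b : B} (hb : b ∈ S) :
    elem r b ∈ supported i S (deg b) :=
  mem_supported.2 fun b' hb' => hS b hb b' (Or.inl hb')

lemma d_elem_mem_supported (hS : IsClosedSet i r S) {b : B} (hb : b ∈ S) :
    X.d rfl (elem r b) ∈ supported i S (deg b + G.one) :=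
  mem_supported.2 fun b' hb' => hS b hb b' (Or.inr hb')

/-- Since `x = r (i x)` and `i x` only involves generators in `S`, the element `x` is a sum of
multiples of the `elem r b` with `b ∈ S`. -/
lemma mem_of_mem_supported (hir : i ≫ r = 𝟙 _) {n : Γ} {x : X.X n} (hx : x ∈ supported i S n)
    (T : AddSubgroup (X.X n))
    (hT : ∀ b ∈ S, ∀ a : 𝒜 (n - deg b), X.act (sub_add_cancel n (deg b)) a (elem r b) ∈ T) :
    x ∈ T := by
  have h := free_mem_of_coord (i.f n x) (T.comap (r.f n)) fun b hb a => by
    change r.f n _ ∈ T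
    rw [r.map_act]
    exact hT b (mem_supported.1 hx b hb) a
  have hx' : r.f n (i.f n x) = x := GrMod.congr_f hir n x
  rw [← hx']
  exact h

/-- By the Leibniz rule `d (a e) = (d a) e ± a (d e)`; closedness keeps both `e = elem r b` and `d
e` supported in `S`. -/
lemma isSubmodule_supported (hir : i ≫ r = 𝟙 _) (hS : IsClosedSet i r S) :
    CDGMod.IsSubmodule (E := X) (supported i S) where
  act_mem h a _ hx := act_mem_supported h a hx
  d_mem {n m} h x hx := by
    subst h
    refine mem_of_mem_supported hir hx ((supported i S (n + G.one)).comap (X.d rfl)) fun b hb a => ?_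
    change X.d rfl (X.act _ a (elem r b)) ∈ supported i S (n + G.one)
    rw [X.leibniz' (sub_add_cancel n (deg b)) rfl (by rw [add_right_comm, sub_add_cancel]) rfl
      (by rw [← add_assoc, sub_add_cancel])]
    refine add_mem (act_mem_supported _ _ (elem_mem_supported hS hb)) ?_
    rw [← map_sign_smul]
    exact act_mem_supported _ _ (zsmul_mem (d_elem_mem_supported hS hb) _)

variable (i r) in
/-- A submodule mapping isomorphically to the submodule supported in a set of generators. -/
structure IsPartialSection {E : CDGMod D} (p : E ⟶ X) (S : Set B)
    (L : ∀ n, AddSubgroup (E.X n)) : Prop where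
  closed : IsClosedSet i r S
  isSubmodule : CDGMod.IsSubmodule L
  injective : ∀ {n : Γ} {x : E.X n}, x ∈ L n → p.f n x = 0 → x = 0
  map_mem : ∀ {n : Γ} {x : E.X n}, x ∈ L n → p.f n x ∈ supported i S n
  exists_mem : ∀ {n : Γ} {x : X.X n}, x ∈ supported i S n → ∃ y ∈ L n, p.f n y = x

/-- The class of modules to which morphisms extend along monomorphisms with graded projective
cokernel to free modules on countably many generators. -/
def HasCountableExtensions (K : CDGMod D) : Prop :=
  ∀ (deg : ULift.{u} ℕ → Γ) (N : CDGMod D) (m : N ⟶ CDGMod.free D deg),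
    cof (gradedProjective D) m → ∀ k : N ⟶ K, ∃ k', m ≫ k' = k

end Filtration

variable {S : ShortComplex (CDGMod D)} {B : Type u} {deg : B → Γ}
  {i : S.X₃.toGrMod ⟶ GrMod.free 𝒜 deg} {r : GrMod.free 𝒜 deg ⟶ S.X₃.toGrMod}

/-- Adjoin the countable closure of `b`. The only obstruction to enlarging the section is a map to
`S.X₁` from a submodule of a countably generated free module, and `hK` removes it. -/
lemma IsPartialSection.exists_larger (hS : S.ShortExact) (hK : HasCountableExtensions S.X₁)
    (hir : i ≫ r = 𝟙 _) {T : Set B} {L : ∀ n, AddSubgroup (S.X₂.X n)}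
    (h : IsPartialSection i r S.g T L) (b : B) :
    ∃ (T' : Set B) (L' : ∀ n, AddSubgroup (S.X₂.X n)), T ⊆ T' ∧ L ≤ L' ∧ b ∈ T' ∧
      IsPartialSection i r S.g T' L' := by
  have := hS.epi_g
  have := hS.mono_f
  let cl : Set B := {b' | Relation.ReflTransGen (Child i r) b b'}
  have hbcl : b ∈ cl := .refl
  obtain ⟨f, hf⟩ : ∃ f : ℕ → B, cl = Set.range f :=
    (countable_setOf_reflTransGen _ (finite_child i r) b).exists_eq_range ⟨b, hbcl⟩
  have hclosed : IsClosedSet i r (T ∪ cl) := by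
    rintro c (hc | hc) c' hcc'
    · exact Or.inl (h.closed c hc c' hcc')
    · exact Or.inr (Relation.ReflTransGen.tail hc hcc')
  let deg' : ULift.{u} ℕ → Γ := fun k => deg (f k.down)
  let q : CDGMod.free D deg' ⟶ S.X₃ := CDGMod.freeHom fun k => elem r (f k.down)
  have hqgen (k : ULift.{u} ℕ) : q.f (deg' k) (CDGMod.gen D deg' k) = elem r (f k.down) :=
    CDGMod.freeHom_gen _ k
  have hqmem (n : Γ) (z : (CDGMod.free D deg').X n) : q.f n z ∈ supported i (T ∪ cl) n := by
    refine CDGMod.free_map_mem (isSubmodule_supported hir hclosed) q (fun k => ?_) n z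
    rw [hqgen]
    exact elem_mem_supported hclosed (Or.inr (hf ▸ Set.mem_range_self k.down))
  have hqelem : ∀ c ∈ cl, ∃ z, q.f (deg c) z = elem r c := fun c hc => by
    obtain ⟨k, rfl⟩ : c ∈ Set.range f := hf ▸ hc
    exact ⟨_, hqgen ⟨k⟩⟩
  let ιL := CDGMod.subι h.isSubmodule
  have : Mono (ιL ≫ S.g) := mono_of_injective _ fun n => by
    rw [injective_iff_map_eq_zero]
    exact fun x hx => Subtype.ext (h.injective x.2 hx)
  -- Here `L` stands for the submodule of `S.X₃` supported in `T`, so `m` is the inclusion of its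
  -- preimage under `q`, and the cokernel of `m` is the piece to be adjoined.
  let m := pullback.fst q (ιL ≫ S.g)
  have hw : m ≫ q = pullback.snd q (ιL ≫ S.g) ≫ ιL ≫ S.g := pullback.condition
  have hm {n : Γ} {z : (CDGMod.free D deg').X n} (hz : q.f n z ∈ supported i T n) :
      ∃ w, m.f n w = z := by
    obtain ⟨y, hy, hyz⟩ := h.exists_mem hz
    obtain ⟨w, hw, -⟩ := CDGMod.exists_pullback_element q (ιL ≫ S.g) z (⟨y, hy⟩ : L n) hyz.symm
    exact ⟨w, hw⟩
  have hcof : cof (gradedProjective D) m := by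
    refine ⟨inferInstance, projective_of_supported (T := cl) D r hir
      (fun c hc => elem_mem_supported h.closed hc) ((CDGMod.forget D).map q)
      ((CDGMod.forget D).map (cokernel.π m)) (CDGMod.surjective_of_epi (cokernel.π m))
      (fun n z => ⟨fun hz => ?_, fun hz => ?_⟩) hqmem hqelem⟩
    · obtain ⟨w, rfl⟩ := exact_apply (shortExact_cokernel m) z hz
      have := CDGMod.congr_f hw n w
      refine (congr_arg (· ∈ supported i T n) this).mpr (h.map_mem (L := L) ?_)
      exact ((pullback.snd q (ιL ≫ S.g)).f n w : L n).2
    · obtain ⟨w, rfl⟩ := hm hz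
      exact CDGMod.congr_f (cokernel.condition m) n w
  have : Projective (CDGMod.free D deg') := CDGMod.projective_free D deg'
  let q' := Projective.factorThru q S.g
  have hq' : q' ≫ S.g = q := Projective.factorThru_comp _ _
  -- On the pullback there are two lifts of `q` to `S.X₂`, namely `q'` and the one given by `L`.
  -- Their difference is `k`; extending it to the free module corrects `q'` to `s`, which agrees
  -- with `L` there.
  let k : pullback q (ιL ≫ S.g) ⟶ S.X₁ := hS.exact.lift (m ≫ q' - pullback.snd _ _ ≫ ιL) (by
    rw [Preadditive.sub_comp, Category.assoc, Category.assoc, hq', hw, sub_self])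
  have hk : k ≫ S.f = m ≫ q' - pullback.snd _ _ ≫ ιL := hS.exact.lift_f _ _
  obtain ⟨k', hk'⟩ := hK deg' _ m hcof k
  let s := q' - k' ≫ S.f
  have hsg : s ≫ S.g = q := by
    rw [Preadditive.sub_comp, Category.assoc, S.zero, comp_zero, sub_zero, hq']
  have hms : m ≫ s = pullback.snd _ _ ≫ ιL := by
    rw [Preadditive.comp_sub, reassoc_of% hk', hk, sub_sub_cancel]
  have hsL {n : Γ} {z : (CDGMod.free D deg').X n} (hz : q.f n z ∈ supported i T n) :
      s.f n z ∈ L n := by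
    obtain ⟨w, rfl⟩ := hm hz
    refine (congr_arg (· ∈ L n) (CDGMod.congr_f hms n w)).mpr ?_
    exact ((pullback.snd q (ιL ≫ S.g)).f n w : L n).2
  have hsgz {n : Γ} (z : (CDGMod.free D deg').X n) : S.g.f n (s.f n z) = q.f n z :=
    CDGMod.congr_f hsg n z
  refine ⟨T ∪ cl, fun n => L n ⊔ (s.f n).range, Set.subset_union_left, fun n => le_sup_left,
    Or.inr hbcl, hclosed, ⟨?_, ?_⟩, ?_, ?_, ?_⟩
  · intro p q t h' a x hx
    obtain ⟨y, hy, _, ⟨z, rfl⟩, rfl⟩ := AddSubgroup.mem_sup.1 hx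
    rw [map_add, ← s.map_act]
    exact AddSubgroup.add_mem_sup (h.isSubmodule.act_mem h' a hy) ⟨_, rfl⟩
  · intro n m h' x hx
    obtain ⟨y, hy, _, ⟨z, rfl⟩, rfl⟩ := AddSubgroup.mem_sup.1 hx
    rw [map_add, ← s.comm]
    exact AddSubgroup.add_mem_sup (h.isSubmodule.d_mem h' hy) ⟨_, rfl⟩
  · intro n x hx hx0
    obtain ⟨y, hy, _, ⟨z, rfl⟩, rfl⟩ := AddSubgroup.mem_sup.1 hx
    rw [map_add, hsgz] at hx0
    -- If `y + s z` is killed by `S.g`, then `q z` is supported in `T`, so `s z` already lies in `L`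
    -- and injectivity on `L` applies.
    have hz : q.f n z ∈ supported i T n := by
      rw [eq_neg_of_add_eq_zero_right hx0]
      exact neg_mem (h.map_mem hy)
    refine h.injective (add_mem hy (hsL hz)) ?_
    rw [map_add, hsgz, hx0]
  · intro n x hx
    obtain ⟨y, hy, _, ⟨z, rfl⟩, rfl⟩ := AddSubgroup.mem_sup.1 hx
    rw [map_add, hsgz]
    exact add_mem (supported_mono Set.subset_union_left n (h.map_mem hy)) (hqmem n z)
  · intro n x hx
    suffices x ∈ (L n ⊔ (s.f n).range).map (S.g.f n) from this
    refine mem_of_mem_supported hir hx _ fun c hc a => ?_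
    rcases hc with hc | hc
    · obtain ⟨y, hy, hy'⟩ := h.exists_mem
        (act_mem_supported (sub_add_cancel n (deg c)) a (elem_mem_supported h.closed hc))
      exact ⟨y, AddSubgroup.mem_sup_left hy, hy'⟩
    · obtain ⟨z, hz⟩ := hqelem c hc
      refine ⟨s.f n ((CDGMod.free D deg').act (sub_add_cancel n (deg c)) a z),
        AddSubgroup.mem_sup_right ⟨_, rfl⟩, ?_⟩
      rw [hsgz, q.map_act, hz]

end CDG

/-! ### Splitting of extensions by Zorn's lemma -/

namespace CDG

open AbelianModel GrMod MorphismProperty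
open scoped ZeroObject

variable {Γ : Type u} [AddCommGroup Γ] [DecidableEq Γ] {G : GradingGroup Γ} {A : Type u} [Ring A]
  {𝒜 : Γ → AddSubgroup A} [GradedRing 𝒜] {D : CDGStructure G 𝒜}

/-- Unions along the chain work; for surjectivity, the support of an element of a free module is
finite and so lies in a single member of the chain. -/
lemma IsPartialSection.exists_upper_bound {X E : CDGMod D} {p : E ⟶ X} {B : Type u} {deg : B → Γ}
    {i : X.toGrMod ⟶ GrMod.free 𝒜 deg} {r : GrMod.free 𝒜 deg ⟶ X.toGrMod}
    (c : Set (Set B × ∀ n, AddSubgroup (E.X n)))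
    (hc : ∀ s ∈ c, IsPartialSection i r p s.1 s.2) (hc' : IsChain (· ≤ ·) c) (hne : c.Nonempty) :
    ∃ s : Set B × ∀ n, AddSubgroup (E.X n), IsPartialSection i r p s.1 s.2 ∧ ∀ t ∈ c, t ≤ s := by
  have : Nonempty c := hne.to_subtype
  have hdir (n : Γ) : Directed (· ≤ ·) fun s : c => s.1.2 n := fun s t => by
    rcases hc'.total s.2 t.2 with h | h
    · exact ⟨t, h.2 n, le_rfl⟩
    · exact ⟨s, le_rfl, h.2 n⟩
  have hdir' : Directed (· ⊆ ·) fun s : c => s.1.1 := fun s t => by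
    rcases hc'.total s.2 t.2 with h | h
    · exact ⟨t, h.1, le_rfl⟩
    · exact ⟨s, le_rfl, h.1⟩
  have hmem {n : Γ} {x : E.X n} : x ∈ ⨆ s : c, s.1.2 n ↔ ∃ s : c, x ∈ s.1.2 n :=
    AddSubgroup.mem_iSup_of_directed (hdir n)
  refine ⟨⟨⋃ s : c, s.1.1, fun n => ⨆ s : c, s.1.2 n⟩, ⟨?_, ⟨?_, ?_⟩, ?_, ?_, ?_⟩, fun t ht =>
    ⟨Set.subset_iUnion (fun s : c => s.1.1) ⟨t, ht⟩,
      fun n => le_iSup (fun s : c => s.1.2 n) ⟨t, ht⟩⟩⟩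
  · intro b hb b' hbb'
    obtain ⟨s, hs⟩ := Set.mem_iUnion.1 hb
    exact Set.mem_iUnion.2 ⟨s, (hc s s.2).closed b hs b' hbb'⟩
  · intro _ _ _ h a x hx
    obtain ⟨s, hs⟩ := hmem.1 hx
    exact hmem.2 ⟨s, (hc s s.2).isSubmodule.act_mem h a hs⟩
  · intro _ _ h x hx
    obtain ⟨s, hs⟩ := hmem.1 hx
    exact hmem.2 ⟨s, (hc s s.2).isSubmodule.d_mem h hs⟩
  · intro _ x hx
    obtain ⟨s, hs⟩ := hmem.1 hx
    exact (hc s s.2).injective hs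
  · intro n x hx
    obtain ⟨s, hs⟩ := hmem.1 hx
    exact supported_mono (Set.subset_iUnion (fun s : c => s.1.1) s) n ((hc s s.2).map_mem hs)
  · intro n x hx
    obtain ⟨s, hs⟩ := hdir'.exists_mem_subset_of_finset_subset_biUnion
      (s := (finite_coord (i.f n x)).toFinset) (by
        exact fun b hb => mem_supported.1 hx b ((Set.Finite.mem_toFinset _).1 hb))
    obtain ⟨y, hy, hyx⟩ := (hc s s.2).exists_mem
      (mem_supported.2 fun b hb => hs ((finite_coord (i.f n x)).mem_toFinset.2 hb))
    exact ⟨y, hmem.2 ⟨s, hy⟩, hyx⟩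

/-- Extensions of graded projective modules split as soon as morphisms to the kernel extend along
countably generated monomorphisms. -/
lemma exists_section_of_gradedProjective {S : ShortComplex (CDGMod D)} (hS : S.ShortExact)
    (hK : HasCountableExtensions S.X₁) (hX : gradedProjective D S.X₃) :
    ∃ σ : S.X₃ ⟶ S.X₂, σ ≫ S.g = 𝟙 _ := by
  obtain ⟨B, deg, r, _⟩ := GrMod.exists_epi_free S.X₃.toGrMod
  have : Projective S.X₃.toGrMod := hX
  let i := Projective.factorThru (𝟙 S.X₃.toGrMod) r
  have hir : i ≫ r = 𝟙 _ := Projective.factorThru_comp _ _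
  have h₀ : IsPartialSection i r S.g ∅ fun _ => ⊥ := by
    refine ⟨fun b hb => hb.elim, ⟨?_, ?_⟩, ?_, ?_, ?_⟩
    · rintro _ _ _ h a x hx
      rw [(hx : x = 0), map_zero]
      exact zero_mem _
    · rintro _ _ h x hx
      rw [(hx : x = 0), map_zero]
      exact zero_mem _
    · exact fun hx _ => hx
    · rintro _ x hx
      rw [(hx : x = 0), map_zero]
      exact zero_mem _
    · refine fun {n x} hx => ⟨0, zero_mem _, ?_⟩
      rw [map_zero]
      exact (mem_of_mem_supported hir hx ⊥ fun b hb => hb.elim).symm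
  obtain ⟨⟨T, L⟩, -, h, hmax⟩ := zorn_le_nonempty₀
    {s : Set B × ∀ n, AddSubgroup (S.X₂.X n) | IsPartialSection i r S.g s.1 s.2}
    (fun c hc hc' y hy => IsPartialSection.exists_upper_bound c hc hc' ⟨y, hy⟩) ⟨∅, fun _ => ⊥⟩ h₀
  -- A maximal partial section already contains every `b`, so its submodule maps isomorphically to
  -- `S.X₃`.
  have hT (b : B) : b ∈ T := by
    obtain ⟨T', L', hT', hL', hb, h'⟩ := h.exists_larger hS hK hir b
    exact (hmax (y := ⟨T', L'⟩) h' ⟨hT', hL'⟩).1 hb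
  let l := CDGMod.subι h.isSubmodule ≫ S.g
  have : Mono l := mono_of_injective _ fun n => by
    rw [injective_iff_map_eq_zero]
    exact fun x hx => Subtype.ext (h.injective x.2 hx)
  have : Epi l := epi_of_surjective _ fun n x => by
    obtain ⟨y, hy, hyx⟩ := h.exists_mem (mem_supported.2 fun b _ => hT b : x ∈ supported i T n)
    exact ⟨(⟨y, hy⟩ : L n), hyx⟩
  have : IsIso l := isIso_of_mono_of_epi l
  exact ⟨inv l ≫ CDGMod.subι h.isSubmodule, by rw [Category.assoc, IsIso.inv_hom_id]⟩

end CDG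

/-! ### From split extensions to extension of morphisms -/

namespace AbelianModel

/-- The pushout of a short exact sequence. -/
lemma shortExact_pushout {C : Type*} [Category C] [Abelian C] {S : ShortComplex C}
    (hS : S.ShortExact) {K : C} (k : S.X₁ ⟶ K) :
    (ShortComplex.mk (pushout.inr S.f k) 
      (pushout.desc S.g (0 : K ⟶ S.X₃) (by rw [S.zero, comp_zero]))
      (pushout.inr_desc _ _ _)).ShortExact := by
  have := hS.mono_f
  have := hS.epi_g
  have h : Epi (pushout.desc S.g (0 : K ⟶ S.X₃) (by rw [S.zero, comp_zero]) : pushout S.f k ⟶ S.X₃) :=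
    epi_of_epi_fac (pushout.inl_desc _ _ _)
  exact
    { exact := ShortComplex.exact_of_g_is_cokernel _ (CokernelCofork.IsColimit.ofπ' _ _
        fun {T} t ht => ⟨hS.exact.desc (pushout.inl S.f k ≫ t) (by
          rw [← Category.assoc, pushout.condition, Category.assoc, ht, comp_zero]), by
            apply pushout.hom_ext
            · rw [pushout.inl_desc_assoc, hS.exact.g_desc]
            · rw [pushout.inr_desc_assoc, zero_comp, ht]⟩)
      mono_f := inferInstanceAs (Mono (pushout.inr S.f k))
      epi_g := h }

end AbelianModel

namespace CDG

open AbelianModel GrMod MorphismProperty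
open scoped ZeroObject

variable {Γ : Type u} [AddCommGroup Γ] [DecidableEq Γ] {G : GradingGroup Γ} {A : Type u} [Ring A]
  {𝒜 : Γ → AddSubgroup A} [GradedRing 𝒜] {D : CDGStructure G 𝒜}

/-- Pushing the sequence out along `k` gives an extension of a graded projective module by `K`; a
splitting of it is an extension of `k`. -/
lemma HasCountableExtensions.exists_extension {K : CDGMod D} (hK : HasCountableExtensions K)
    {S : ShortComplex (CDGMod D)} (hS : S.ShortExact) (hX : gradedProjective D S.X₃)
    (k : S.X₁ ⟶ K) : ∃ k', S.f ≫ k' = k := by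
  have h := shortExact_pushout hS k
  obtain ⟨σ, hσ⟩ := exists_section_of_gradedProjective h hK hX
  let s := ShortComplex.Splitting.ofExactOfSection _ h.exact σ hσ h.mono_f
  refine ⟨pushout.inl S.f k ≫ s.r, ?_⟩
  rw [← Category.assoc, pushout.condition, Category.assoc]
  exact (congr_arg (k ≫ ·) s.f_r).trans (Category.comp_id k)

/-! ### Generators of the contraderived model structure -/

variable (D) in
/-- The generating cofibrations of the contraderived model structure. -/
noncomputable def contraderivedGenerators : MorphismProperty (CDGMod D) :=
  ofHoms fun N : Σ deg : ULift.{u} ℕ → Γ, {N : Subobject (CDGMod.free D deg) //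
    gradedProjective D (cokernel N.arrow)} => N.2.1.arrow

instance : MorphismProperty.IsSmall.{u} (contraderivedGenerators D) := by
  unfold contraderivedGenerators
  infer_instance

lemma contraderivedGenerators_le_cof : contraderivedGenerators D ≤ cof (gradedProjective D) := by
  rintro _ _ _ ⟨⟨deg, N, hN⟩⟩
  exact ⟨inferInstanceAs (Mono N.arrow), hN⟩

instance : HasSmallObjectArgument.{u} (contraderivedGenerators D) :=
  IsGrothendieckAbelian.hasSmallObjectArgument _ fun _ _ _ h => (contraderivedGenerators_le_cof _ h).1

/-- The generators use subobjects only to form a set; any such monomorphism is isomorphic, as an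
arrow, to one of them. -/
lemma hasLiftingProperty_of_rlp_contraderivedGenerators {X Y : CDGMod D} {f : X ⟶ Y}
    (hf : (contraderivedGenerators D).rlp f) {deg : ULift.{u} ℕ → Γ} {N : CDGMod D}
    {m : N ⟶ CDGMod.free D deg} (hm : cof (gradedProjective D) m) : HasLiftingProperty m f := by
  have := hm.1
  let e : CategoryTheory.Arrow.mk (Subobject.mk m).arrow ≅ CategoryTheory.Arrow.mk m :=
    CategoryTheory.Arrow.isoMk (Subobject.underlyingIso m) (Iso.refl _) (by
      change (Subobject.underlyingIso m).hom ≫ m = (Subobject.mk m).arrow ≫ 𝟙 _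
      rw [Subobject.underlyingIso_hom_comp_eq_mk, Category.comp_id])
  have := cof_isStableUnderRetracts (P := gradedProjective D) inferInstance
  have h : cof (gradedProjective D) (Subobject.mk m).arrow := (arrow_mk_iso_iff _ e).2 hm
  have : HasLiftingProperty (Subobject.mk m).arrow f :=
    hf _ (ofHoms.mk (f := fun N : Σ deg : ULift.{u} ℕ → Γ, {N : Subobject (CDGMod.free D deg) //
      gradedProjective D (cokernel N.arrow)} => N.2.1.arrow) ⟨deg, Subobject.mk m, h.2⟩)
  exact HasLiftingProperty.of_arrow_iso_left e f

lemma epi_of_rlp_contraderivedGenerators {X Y : CDGMod D} {f : X ⟶ Y}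
    (hf : (contraderivedGenerators D).rlp f) : Epi f :=
  epi_of_surjective f fun n y => by
    -- The test modules have generators indexed by the natural numbers, so the degree `n` is
    -- repeated and only generator `0` is used.
    let deg : ULift.{u} ℕ → Γ := fun _ => n
    have hm : cof (gradedProjective D) (0 : 0 ⟶ CDGMod.free D deg) :=
      cof_zero inferInstance (gradedProjective_of_projective _ (CDGMod.projective_free D deg))
    have := hasLiftingProperty_of_rlp_contraderivedGenerators hf hm
    have sq : CommSq (0 : 0 ⟶ X) (0 : 0 ⟶ CDGMod.free D deg) f (CDGMod.freeHom fun _ => y) := ⟨by simp⟩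
    refine ⟨sq.lift.f n (CDGMod.gen D deg ⟨0⟩), (CDGMod.congr_f sq.fac_right n _).trans ?_⟩
    exact CDGMod.freeHom_gen (deg := deg) (fun _ => y) ⟨0⟩

lemma hasCountableExtensions_of_rlp {X Y : CDGMod D} {f : X ⟶ Y}
    (hf : (contraderivedGenerators D).rlp f) : HasCountableExtensions (kernel f) := by
  intro deg N m hm k
  have := hasLiftingProperty_of_rlp_contraderivedGenerators hf hm
  have sq : CommSq (k ≫ kernel.ι f) m f 0 := ⟨by simp⟩
  refine ⟨kernel.lift f sq.lift sq.fac_right, ?_⟩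
  rw [← cancel_mono (kernel.ι f), Category.assoc, kernel.lift_ι, sq.fac_left]

/-- Lifting against the generators makes `f` an epimorphism whose kernel passes the countable test.
Maps to that kernel then extend along the kernel of a projective presentation of `cokernel i`, which
is all that `hasLiftingProperty_of_extension` requires. -/
lemma rlp_contraderivedGenerators :
    (contraderivedGenerators D).rlp = (cof (gradedProjective D)).rlp := by
  refine le_antisymm (fun X Y f hf A B i hi => ?_) (antitone_rlp contraderivedGenerators_le_cof)
  have := epi_of_rlp_contraderivedGenerators hf
  have := hi.1
  exact hasLiftingProperty_of_extension i f (Projective.π (cokernel i)) fun k =>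
    (hasCountableExtensions_of_rlp hf).exists_extension (shortExact_kernel (Projective.π _)) hi.2 k

end CDG

/-! ### Factorization and cofibrant generation, contraderived case -/

namespace CDG

open AbelianModel MorphismProperty
open scoped ZeroObject

variable {Γ : Type u} [AddCommGroup Γ] [DecidableEq Γ] {G : GradingGroup Γ} {A : Type u} [Ring A]
  {𝒜 : Γ → AddSubgroup A} [GradedRing 𝒜] {D : CDGStructure G 𝒜}

/-- Extend `a` along the graded split `i`; the error in the lower triangle is a map from `cokernel
i` to a contractible module, which lifts along `e` by adjunction and graded projectivity. -/
lemma rlp_cof_coneFunctor_map {M N : GrMod 𝒜} (e : M ⟶ N) [Epi e] :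
    (cof (gradedProjective D)).rlp ((coneFunctor D).map e) := by
  intro A B i hi
  refine ⟨fun {a b} sq => ?_⟩
  obtain ⟨l, hl⟩ := exists_extension_cone hi a
  have w : i ≫ (b - l ≫ (coneFunctor D).map e) = 0 := by
    rw [Preadditive.comp_sub, reassoc_of% hl, sq.w, sub_self]
  have : Projective ((CDGMod.forget D).obj (cokernel i)) := hi.2
  let adj := forgetAdjunction D
  let t : cokernel i ⟶ (coneFunctor D).obj M := adj.homEquiv _ _
    (Projective.factorThru ((adj.homEquiv _ _).symm (cokernel.desc i _ w)) e)
  have ht : t ≫ (coneFunctor D).map e = cokernel.desc i _ w := by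
    rw [← Adjunction.homEquiv_naturality_right, Projective.factorThru_comp,
      Equiv.apply_symm_apply]
  exact ⟨⟨{ l := l + cokernel.π i ≫ t
            fac_left := by simp [hl]
            fac_right := by simp [ht] }⟩⟩

lemma rlp_cof_cone_zero (M : GrMod 𝒜) :
    (cof (gradedProjective D)).rlp (0 : (coneFunctor D).obj M ⟶ 0) := by
  intro A B i hi
  refine ⟨fun {a b} sq => ?_⟩
  obtain ⟨l, hl⟩ := exists_extension_cone hi a
  exact ⟨⟨{ l := l, fac_left := hl, fac_right := (isZero_zero _).eq_of_tgt _ _ }⟩⟩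

/-- Two kinds of test maps recover membership in `cof`: contractible modules over `0` force `j` to
be mono, and contractible modules on epimorphisms force its cokernel to be graded projective. The
small object argument thus yields a factor in `cof` without a study of transfinite compositions of
cofibrations. -/
lemma llp_rlp_cof_le : (cof (gradedProjective D)).rlp.llp ≤ cof (gradedProjective D) := by
  intro X Y j hj
  have h₁ := hj _ (rlp_cof_cone_zero ((CDGMod.forget D).obj X))
  have sq₁ : CommSq (coneUnit X) j (0 : (coneFunctor D).obj _ ⟶ 0) 0 := ⟨by simp⟩
  have : Mono (j ≫ sq₁.lift) := by
    rw [sq₁.fac_left]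
    infer_instance
  refine ⟨mono_of_mono j sq₁.lift, ⟨fun {N M} φ e _ => ?_⟩⟩
  have h₂ := hj _ (rlp_cof_coneFunctor_map e)
  let adj := forgetAdjunction D
  have sq₂ : CommSq 0 j ((coneFunctor D).map e) (cokernel.π j ≫ adj.homEquiv _ _ φ) := ⟨by simp⟩
  refine ⟨(adj.homEquiv _ _).symm (cokernel.desc j sq₂.lift sq₂.fac_left), ?_⟩
  rw [← Adjunction.homEquiv_naturality_right_symm, Equiv.symm_apply_eq, ← cancel_epi (cokernel.π j),
    cokernel.π_desc_assoc, sq₂.fac_right]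

instance : (cof (gradedProjective D)).HasFactorization (cof (gradedProjective D)).rlp where
  nonempty_mapFactorizationData f := by
    obtain h := factorizationData (contraderivedGenerators D).rlp.llp
      (contraderivedGenerators D).rlp f
    rw [rlp_contraderivedGenerators] at h
    exact ⟨{ h with hi := llp_rlp_cof_le _ h.hi, hp := h.hp }⟩

variable (D) in
/-- The generating trivial cofibrations of the contraderived model structure. -/
noncomputable def contraderivedTrivialGenerators : MorphismProperty (CDGMod D) :=
  ofHoms fun n : Γ => (0 : 0 ⟶ CDGMod.free D fun _ : PUnit.{u + 1} => n)

instance : MorphismProperty.IsSmall.{u} (contraderivedTrivialGenerators D) := by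
  unfold contraderivedTrivialGenerators
  infer_instance

instance : HasSmallObjectArgument.{u} (contraderivedTrivialGenerators D) :=
  IsGrothendieckAbelian.hasSmallObjectArgument _ (by
    intro _ _ _ h
    obtain ⟨n⟩ := h
    exact inferInstanceAs (Mono (0 : 0 ⟶ CDGMod.free D fun _ : PUnit.{u + 1} => n)))

lemma rlp_contraderivedTrivialGenerators :
    (contraderivedTrivialGenerators D).rlp = epimorphisms (CDGMod D) := by
  ext S T f
  refine ⟨fun hf => epi_of_surjective f fun n y => ?_, fun (hf : Epi f) => ?_⟩
  · let deg : PUnit.{u + 1} → Γ := fun _ => n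
    have : HasLiftingProperty (0 : 0 ⟶ CDGMod.free D deg) f := hf _ ⟨n⟩
    have sq : CommSq (0 : 0 ⟶ S) (0 : 0 ⟶ CDGMod.free D deg) f (CDGMod.freeHom fun _ => y) :=
      ⟨by simp⟩
    refine ⟨sq.lift.f n (CDGMod.gen D deg ⟨⟩), (CDGMod.congr_f sq.fac_right n _).trans ?_⟩
    exact CDGMod.freeHom_gen (deg := deg) (fun _ => y) ⟨⟩
  · intro _ _ _ h
    obtain ⟨n⟩ := h
    have := CDGMod.projective_free D fun _ : PUnit.{u + 1} => n
    exact ⟨fun {a b} sq => ⟨⟨{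
      l := Projective.factorThru b f
      fac_left := (isZero_zero _).eq_of_src _ _
      fac_right := Projective.factorThru_comp _ _ }⟩⟩⟩

lemma existsUnique_isContraderivedModel :
    ∃! M : ModelCategory (CDGMod D), IsContraderivedModel M :=
  existsUnique_projective isCofibrantClass_gradedProjective

lemma isCofibrantlyGenerated_of_isContraderivedModel (M : ModelCategory (CDGMod D))
    (hM : IsContraderivedModel M) : IsCofibrantlyGenerated.{u} M := by
  obtain ⟨h₁, h₂⟩ :=
    (isProjectiveAbelianModel_iff (P := gradedProjective D) inferInstance M).1 hM
  refine ⟨contraderivedGenerators D, contraderivedTrivialGenerators D, inferInstance, inferInstance,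
    inferInstance, inferInstance, ?_, ?_⟩
  · rw [rlp_contraderivedGenerators, ← h₁,
      rlp_eq_of_wfs (cofibrations (CDGMod D)) (trivialFibrations (CDGMod D))]
  · rw [rlp_contraderivedTrivialGenerators, h₂]

end CDG

theorem mainTheorem11 {Γ : Type u} [AddCommGroup Γ] [DecidableEq Γ] (G : CDG.GradingGroup Γ)
    {A : Type u} [Ring A] (𝒜 : Γ → AddSubgroup A) [GradedRing 𝒜] (D : CDG.CDGStructure G 𝒜) :
    (HasLimitsOfSize.{u, u} (CDG.CDGMod D) ∧ HasColimitsOfSize.{u, u} (CDG.CDGMod D)) ∧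
    (∃! M : ModelCategory (CDG.CDGMod D), CDG.IsContraderivedModel M) ∧
    (∃! M : ModelCategory (CDG.CDGMod D), CDG.IsCoderivedModel M) ∧
    (∀ M : ModelCategory (CDG.CDGMod D), CDG.IsContraderivedModel M →
      CDG.IsCofibrantlyGenerated.{u} M) ∧
    (∀ M : ModelCategory (CDG.CDGMod D), CDG.IsCoderivedModel M →
      CDG.IsCofibrantlyGenerated.{u} M) :=
  ⟨⟨inferInstance, inferInstance⟩, CDG.existsUnique_isContraderivedModel,
    CDG.existsUnique_isCoderivedModel, CDG.isCofibrantlyGenerated_of_isContraderivedModel,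
    CDG.isCofibrantlyGenerated_of_isCoderivedModel⟩
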